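/- Let $\Bbbk$ be a field and let $R=\bigoplus_{n\ge 0}R_n$ and $S=\bigoplus_{n\ge 0}S_n$ be standard graded $\Bbbk$-algebras, that is, graded quotients of polynomial rings over $\Bbbk$ in finitely many variables of degree $1$ by homogeneous ideals. Let $R\#S=\bigoplus_{n\ge 0}R_n\otimes_{\Bbbk}S_n\subseteq R\otimes_{\Bbbk}S$ be their Segre product. Let $I\subsetneq R$ and $J\subsetneq S$ be proper homogeneous ideals, and let $I\#J=\bigoplus_{n\ge 0}I_n\otimes_{\Bbbk}J_n$, where $I_n=I\cap R_n$ and $J_n=J\cap S_n$; this is an ideal of $R\#S$. For an ideal $\mathfrak a$ of a Noetherian commutative ring $A$ put $\operatorname{cd}_{\mathfrak a}(A)=\sup\{i \mid H^i_{\mathfrak a}(A)\neq 0\}$, where $H^i_{\mathfrak a}$ denotes local cohomology. 1. If $\operatorname{cd}_I(R)\cdot\operatorname{cd}_J(S)=0$ (that is, $\operatorname{cd}_I(R)=0$ or $\operatorname{cd}_J(S)=0$), then $$\operatorname{cd}_{I\#J}(R\#S)\le \operatorname{cd}_I(R)+\operatorname{cd}_J(S).$$ 2. If $\operatorname{cd}_I(R)\ge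 1$ and $\operatorname{cd}_J(S)\ge 1$, then $$\operatorname{cd}_{I\#J}(R\#S)\le \operatorname{cd}_I(R)+\operatorname{cd}_J(S)-1.$$ -/

import Mathlib

open scoped TensorProduct

universe u v w

/-- The cohomological dimension `sup {i | H^i_𝔞(A) ≠ 0}` of a commutative ring `A` with respect to
an ideal `𝔞`. The supremum is taken in `{-∞} ∪ ℕ ∪ {∞}`, so it is `⊥ = -∞` if all the local
cohomology modules vanish. -/
noncomputable def cohomologicalDimension {A : Type u} [CommRing A] (𝔞 : Ideal A) : WithBot ℕ∞ :=
  ⨆ (i : ℕ) (_ : ¬ CategoryTheory.Limits.IsZero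
    ((localCohomology 𝔞 i).obj (ModuleCat.of A A))), ((i : ℕ∞) : WithBot ℕ∞)

/-- An `ℕ`-graded `k`-algebra is standard graded if it is, as a graded `k`-algebra, a quotient
`k[x₁, …, xₙ] / 𝔟` of a polynomial ring in finitely many variables of degree `1` by a homogeneous
ideal. Equivalently, there is a surjective degree-preserving homomorphism of `k`-algebras from such
a polynomial ring onto it (whose kernel `𝔟` is then homogeneous). -/
def IsStandardGraded {k : Type w} {R : Type u} [Field k] [CommRing R] [Algebra k R]
    (𝒜 : ℕ → Submodule k R) [GradedAlgebra 𝒜] : Prop :=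
  ∃ (n : ℕ) (φ : MvPolynomial (Fin n) k →ₐ[k] R), Function.Surjective φ ∧
    ∀ (d : ℕ) (p : MvPolynomial (Fin n) k), p.IsHomogeneous d → φ p ∈ 𝒜 d

section Segre

variable {k : Type w} {R : Type u} {S : Type v} [Field k] [CommRing R] [CommRing S]
  [Algebra k R] [Algebra k S]

/-- For families of subspaces `M n ⊆ R` and `N n ⊆ S`, the subspace `∑ n, M n ⊗ N n` of `R ⊗ S`.
As `k` is a field, `M n ⊗ N n` embeds into `R ⊗ S`, and the sum is direct if `M n` and `N n` lie
in the degree `n` pieces of gradings of `R` and `S`. -/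
def segreSubmodule (M : ℕ → Submodule k R) (N : ℕ → Submodule k S) : Submodule k (R ⊗[k] S) :=
  ⨆ n, Submodule.map₂ (TensorProduct.mk k R S) (M n) (N n)

/-- Products of `∑ n, M n ⊗ N n` and `∑ n, M' n ⊗ N' n` lie in `∑ n, M'' n ⊗ N'' n` as soon as
`M m * M' n ⊆ M'' (m + n)` and `N m * N' n ⊆ N'' (m + n)`. -/
theorem segreSubmodule_mul_mem {M M' M'' : ℕ → Submodule k R} {N N' N'' : ℕ → Submodule k S}
    (hM : ∀ m n, ∀ a ∈ M m, ∀ b ∈ M' n, a * b ∈ M'' (m + n))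
    (hN : ∀ m n, ∀ a ∈ N m, ∀ b ∈ N' n, a * b ∈ N'' (m + n))
    {x y : R ⊗[k] S} (hx : x ∈ segreSubmodule M N) (hy : y ∈ segreSubmodule M' N') :
    x * y ∈ segreSubmodule M'' N'' := by
  have key : segreSubmodule M N * segreSubmodule M' N' ≤ segreSubmodule M'' N'' := by
    unfold segreSubmodule
    rw [Submodule.iSup_mul]
    refine iSup_le fun m => ?_
    rw [Submodule.mul_iSup]
    refine iSup_le fun n => ?_
    refine le_trans ?_ (le_iSup _ (m + n))
    rw [Submodule.map₂_eq_span_image2, Submodule.map₂_eq_span_image2, Submodule.span_mul_span,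
      Submodule.span_le]
    rintro _ ⟨_, ⟨a, ha, b, hb, rfl⟩, _, ⟨a', ha', b', hb', rfl⟩, rfl⟩
    have h := Submodule.apply_mem_map₂ (TensorProduct.mk k R S) (hM m n a ha a' ha')
      (hN m n b hb b' hb')
    simpa using h
  exact key (Submodule.mul_mem_mul hx hy)

/-- The Segre product `R # S = ⨁ n, R_n ⊗ S_n` of two graded `k`-algebras, as a subalgebra of
`R ⊗ S`. -/
def segreProduct (𝒜 : ℕ → Submodule k R) (ℬ : ℕ → Submodule k S) [GradedAlgebra 𝒜]
    [GradedAlgebra ℬ] : Subalgebra k (R ⊗[k] S) where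
  carrier := segreSubmodule 𝒜 ℬ
  add_mem' := (segreSubmodule 𝒜 ℬ).add_mem
  mul_mem' := segreSubmodule_mul_mem (fun _ _ _ ha _ hb => SetLike.mul_mem_graded ha hb)
    (fun _ _ _ ha _ hb => SetLike.mul_mem_graded ha hb)
  algebraMap_mem' r := by
    have h : algebraMap k R r ⊗ₜ[k] (1 : S) ∈ segreSubmodule 𝒜 ℬ :=
      le_iSup (fun n => Submodule.map₂ (TensorProduct.mk k R S) (𝒜 n) (ℬ n)) 0
        (Submodule.apply_mem_map₂ (TensorProduct.mk k R S)
          (SetLike.algebraMap_mem_graded 𝒜 r) (SetLike.one_mem_graded ℬ))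
    simpa [Algebra.TensorProduct.algebraMap_apply] using h

/-- The Segre product `I # J = ⨁ n, I_n ⊗ J_n` of two ideals, as an ideal of `R # S`; here
`I_n = I ∩ R_n` and `J_n = J ∩ S_n`. -/
def segreIdeal (𝒜 : ℕ → Submodule k R) (ℬ : ℕ → Submodule k S) [GradedAlgebra 𝒜]
    [GradedAlgebra ℬ] (I : Ideal R) (J : Ideal S) : Ideal (segreProduct 𝒜 ℬ) where
  carrier := {t | (t : R ⊗[k] S) ∈ segreSubmodule
    (fun n => 𝒜 n ⊓ I.restrictScalars k) (fun n => ℬ n ⊓ J.restrictScalars k)}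
  add_mem' := (segreSubmodule _ _).add_mem
  zero_mem' := (segreSubmodule _ _).zero_mem
  smul_mem' c _ hx := segreSubmodule_mul_mem
    (M' := fun n => 𝒜 n ⊓ I.restrictScalars k) (N' := fun n => ℬ n ⊓ J.restrictScalars k)
    (M'' := fun n => 𝒜 n ⊓ I.restrictScalars k) (N'' := fun n => ℬ n ⊓ J.restrictScalars k)
    (fun _ _ _ ha _ hb => ⟨SetLike.mul_mem_graded ha hb.1, I.mul_mem_left _ hb.2⟩)
    (fun _ _ _ ha _ hb => ⟨SetLike.mul_mem_graded ha hb.1, J.mul_mem_left _ hb.2⟩) c.2 hx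

end Segre

/-!
Local cohomology `H^i_I(M)` is a colimit of the modules `Ext^i(R / I^n, M)`, so it vanishes if and
only if each class in `Ext^i(R / I^n, M)` dies in `Ext^i(R / I^m, M)` for some `m ≥ n`
(`isZero_localCohomology_iff`). In this form the long exact sequences become statements about three
consecutive vanishing conditions. Over a Noetherian ring, the Artin-Rees lemma shows that torsion
modules have no higher local cohomology (`IsTorsion.vanishes_succ`).

If `I` is generated up to radical by a finite set `F`, each module `M` maps with torsion kernel to
the product `X` of its localizations at the elements of `F` (`exists_cover`), and `X` has no local
cohomology at all, since its identity is a combination of endomorphisms with coefficients in `I`.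
If `M` has cohomological dimension at most `c + 1` with `c ≥ 1`, then the cokernel of `M ⟶ X` has
cohomological dimension at most `c`; if `M` has cohomological dimension at most `1`, then up to
torsion kernel and cokernel `M` is a module without local cohomology (`exists_forall_vanishes`).
As `k` is a field, `- ⊗ N` and `M ⊗ -` are exact, and they carry torsion modules to torsion modules.
Dimension shifting along them, first in one factor and then in the other, reduces the bound
`c + d + 1` for `M ⊗ N`, where `M` and `N` have cohomological dimension at most `c + 1` and `d + 1`,
to the case of products of localizations, where the identity of `X ⊗ Y` is again a combination of
endomorphisms with coefficients `f ⊗ f'` in the ideal (`OuterTensor.vanishes_of_lt`).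

For the Segre product, `R # S` is a direct summand of `R ⊗ S` as a module over itself, by projection
onto the diagonal degrees (`segreRetraction`). Hence it is Noetherian, and the vanishing for
`R ⊗ S`, which is not restricted to diagonal degrees, implies that for `R # S`. The generators of
`I` and `J` are replaced by powers of a common degree, so that the products `f ⊗ f'` lie in `I # J`.
This gives the bound for positive cohomological dimensions (`vanishes_segreIdeal`).

If `I` has cohomological dimension zero, then `R` is the sum of `I` and the `I`-torsion ideal
(`exists_one_sub_mem_torsionSubmodule`): the quotient `Z` of `R` by the torsion has no local
cohomology, whence `Z = I Z` by an argument with regular elements. So `1 - b` is torsion for some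
`b ∈ I`. As `I` is proper and homogeneous, `b` has no component of degree zero and `1 - b` is a
nonzerodivisor, so that `I` is nil. Then `I # J` is nil as well, and its cohomological dimension is
at most zero. Cohomological dimensions of proper ideals are never `-∞`, so that this is the bound
required.
-/

namespace SegreCohomology

open CategoryTheory Limits Opposite

/-! ### Local cohomology in terms of Yoneda extensions -/

/-- A cocycle of degree `n` represents zero in `Ext` if and only if it is a coboundary. In degree
`0` the differential `P.complex.d 0 (0 - 1)` is zero. -/
theorem extMk_eq_zero_iff_exists {C : Type v} [Category.{w} C] [Abelian C] [HasExt.{w} C]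
    {X Y : C} (P : ProjectiveResolution X) {n : ℕ}
    (f : P.complex.X n ⟶ Y) (hf : P.complex.d (n + 1) n ≫ f = 0) :
    P.extMk f (n + 1) rfl hf = 0 ↔
      ∃ g : P.complex.X (n - 1) ⟶ Y, P.complex.d n (n - 1) ≫ g = f := by
  rcases n with - | n
  · simp only [← P.extEquivCohomologyClass.apply_eq_iff_eq,
      ProjectiveResolution.extEquivCohomologyClass_extMk,
      ProjectiveResolution.extEquivCohomologyClass_zero,
      CochainComplex.HomComplex.CohomologyClass.mk_eq_zero_iff]
    rw [CochainComplex.HomComplex.Cocycle.toSingleMk_mem_coboundaries_iff _ _ _ _ _ 1 (by lia)]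
    have h1 : P.cochainComplex.d (-((0 : ℕ) : ℤ)) 1 = 0 :=
      (P.cochainComplex.isZero_of_isStrictlyLE 0 1 (by lia)).eq_of_tgt _ _
    have h2 : P.complex.d 0 (0 - 1) = 0 := P.complex.shape _ _ (by simp)
    simp only [h1, h2, zero_comp, exists_const]
    rw [eq_comm, eq_comm (a := (0 : P.complex.X 0 ⟶ Y))]
    exact Preadditive.IsIso.comp_left_eq_zero _ _
  · exact P.extMk_eq_zero_iff f _ rfl hf n rfl

section DerivedExt

variable {R : Type u} [CommRing R] {C : Type v} [Category.{w} C] [Abelian C] [Linear R C]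
  [EnoughProjectives C]

/-- The complex `Hom(P, Y)`, as a chain complex in the opposite of the category of modules. It is
the complex whose homology defines the derived functor `Ext`. -/
noncomputable abbrev homComplex (R : Type u) [CommRing R] [Linear R C] (P : ChainComplex C ℕ)
    (Y : C) : ChainComplex (ModuleCat.{w} R)ᵒᵖ ℕ :=
  (((linearYoneda R C).obj Y).rightOp.mapHomologicalComplex _).obj P

/-- The derived functor `Ext`, computed with a projective resolution. -/
noncomputable def extIsoHomology {X : C} (P : ProjectiveResolution X) (n : ℕ) (Y : C) :
    ((Ext R C n).obj (op X)).obj Y ≅ ((homComplex R P.complex Y).homology n).unop :=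
  (P.isoLeftDerivedObj ((linearYoneda R C).obj Y).rightOp n).unop.symm

/-- The cocycle `f` represents the class `e` in the derived functor `Ext`, computed with the
projective resolution `P`. -/
def Represents {X Y : C} (P : ProjectiveResolution X) {n : ℕ}
    (e : ((Ext R C n).obj (op X)).obj Y) (f : P.complex.X n ⟶ Y) : Prop :=
  ∃ z : ((homComplex R P.complex Y).opcycles n).unop,
    ((homComplex R P.complex Y).homologyι n).unop.hom z =
      (extIsoHomology P n Y).hom.hom e ∧
    ((homComplex R P.complex Y).pOpcycles n).unop.hom z = f

theorem Represents.comp_eq_zero {X Y : C} {P : ProjectiveResolution X} {n : ℕ}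
    {e : ((Ext R C n).obj (op X)).obj Y} {f : P.complex.X n ⟶ Y} (h : Represents P e f) :
    P.complex.d (n + 1) n ≫ f = 0 := by
  obtain ⟨z, -, rfl⟩ := h
  have := congrArg Quiver.Hom.unop ((homComplex R P.complex Y).d_pOpcycles (n + 1) n)
  exact congrArg (fun g => g.hom z) this

theorem exists_represents {X Y : C} (P : ProjectiveResolution X) {n : ℕ}
    (e : ((Ext R C n).obj (op X)).obj Y) :
    ∃ f, Represents P e f := by
  have : Function.Surjective ((homComplex R P.complex Y).homologyι n).unop.hom :=
    (ModuleCat.epi_iff_surjective _).1 inferInstance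
  obtain ⟨z, hz⟩ := this ((extIsoHomology P n Y).hom.hom e)
  exact ⟨_, z, hz, rfl⟩

theorem exists_represents_of_comp_eq_zero {X Y : C} (P : ProjectiveResolution X) {n : ℕ}
    (f : P.complex.X n ⟶ Y) (hf : P.complex.d (n + 1) n ≫ f = 0) :
    ∃ e : ((Ext R C n).obj (op X)).obj Y, Represents P e f := by
  have hE : (ShortComplex.mk _ _ ((homComplex R P.complex Y).d_pOpcycles (n + 1) n)).Exact :=
    ShortComplex.exact_of_g_is_cokernel _
      ((homComplex R P.complex Y).opcyclesIsCokernel (n + 1) n (by simp))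
  have h2 := (ShortComplex.moduleCat_exact_iff _).1 hE.unop f hf
  obtain ⟨z, hz⟩ := h2
  exact ⟨(extIsoHomology P n Y).inv.hom (((homComplex R P.complex Y).homologyι n).unop.hom z), z,
    congrArg (fun g => g.hom (((homComplex R P.complex Y).homologyι n).unop.hom z))
      (extIsoHomology (R := R) P n Y).inv_hom_id.symm, hz⟩

/-- A class vanishes if and only if a cocycle that represents it is a coboundary. -/
theorem Represents.eq_zero_iff {X Y : C} {P : ProjectiveResolution X} {n : ℕ}
    {e : ((Ext R C n).obj (op X)).obj Y} {f : P.complex.X n ⟶ Y} (h : Represents P e f) :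
    e = 0 ↔ ∃ g : P.complex.X (n - 1) ⟶ Y, P.complex.d n (n - 1) ≫ g = f := by
  obtain ⟨z, hz, rfl⟩ := h
  have hι : (homComplex R P.complex Y).homologyι n ≫
      (homComplex R P.complex Y).fromOpcycles n (n - 1) = 0 := by simp
  have hE : (ShortComplex.mk _ _ hι).Exact :=
    ShortComplex.exact_of_f_is_kernel _ ((homComplex R P.complex Y).homologyIsKernel n (n - 1)
      (by cases n <;> simp))
  have hE' := (ShortComplex.moduleCat_exact_iff _).1 hE.unop z
  have hp : Function.Injective ((homComplex R P.complex Y).pOpcycles n).unop.hom :=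
    (ModuleCat.mono_iff_injective _).1 inferInstance
  have hinv : Function.Injective (extIsoHomology (R := R) P n Y).hom.hom :=
    (ModuleCat.mono_iff_injective _).1 inferInstance
  have hd (g : P.complex.X (n - 1) ⟶ Y) : ((homComplex R P.complex Y).pOpcycles n).unop.hom
      (((homComplex R P.complex Y).fromOpcycles n (n - 1)).unop.hom g) =
        P.complex.d n (n - 1) ≫ g :=
    congrArg (fun φ => φ.unop.hom g) ((homComplex R P.complex Y).p_fromOpcycles n (n - 1))
  constructor
  · rintro rfl
    rw [map_zero] at hz
    obtain ⟨g, hg⟩ := hE' hz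
    exact ⟨g, (hd g).symm.trans (congrArg _ hg)⟩
  · rintro ⟨g, hg⟩
    have hz' := hp ((hd g).trans hg)
    apply hinv
    rw [map_zero, ← hz, ← hz']
    exact congrArg (fun φ => φ.unop.hom g) hι

theorem Represents.map {X X' Y : C} {P : ProjectiveResolution X} {P' : ProjectiveResolution X'}
    {n : ℕ} {e : ((Ext R C n).obj (op X)).obj Y} {f : P.complex.X n ⟶ Y} (h : Represents P e f)
    {g : X' ⟶ X} (φ : P'.complex ⟶ P.complex) (hφ : φ.f 0 ≫ P.π.f 0 = P'.π.f 0 ≫ g) :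
    Represents P' ((((Ext R C n).map g.op).app Y).hom e) (φ.f n ≫ f) := by
  obtain ⟨z, hz, rfl⟩ := h
  let Φ : homComplex R P'.complex Y ⟶ homComplex R P.complex Y :=
    (((linearYoneda R C).obj Y).rightOp.mapHomologicalComplex _).map φ
  refine ⟨(HomologicalComplex.opcyclesMap Φ n).unop.hom z, ?_, ?_⟩
  · have h1 := congrArg (fun ψ => ψ.unop.hom z) (HomologicalComplex.homologyι_naturality Φ n)
    have h2 := congrArg (fun ψ => ψ.unop.hom e)
      (ProjectiveResolution.isoLeftDerivedObj_inv_naturality g P' P φ hφ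
        ((linearYoneda R C).obj Y).rightOp n)
    exact h1.symm.trans ((congrArg (HomologicalComplex.homologyMap Φ n).unop.hom hz).trans h2.symm)
  · exact congrArg (fun ψ => ψ.unop.hom z) (HomologicalComplex.p_opcyclesMap Φ n)

/-- The derived functor `Ext` and the groups of Yoneda extensions compare in a way that preserves
the vanishing of a class after restriction along a morphism. -/
theorem map_eq_zero_iff_of_represents [HasExt.{w} C] {X X' Y : C} (P : ProjectiveResolution X)
    (P' : ProjectiveResolution X') {n : ℕ} {e : ((Ext R C n).obj (op X)).obj Y}
    {f : P.complex.X n ⟶ Y} (h : Represents P e f) (g : X' ⟶ X) :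
    (((Ext R C n).map g.op).app Y).hom e = 0 ↔
      (Abelian.Ext.mk₀ g).comp (P.extMk f (n + 1) rfl h.comp_eq_zero) (zero_add n) = 0 := by
  let φ : ProjectiveResolution.Hom P' P g :=
    ⟨ProjectiveResolution.lift g P' P, by
      simpa using ProjectiveResolution.lift_commutes_zero g P' P⟩
  have hm := h.map φ.hom (by simpa using φ.hom_f_zero_comp_π_f_zero)
  rw [hm.eq_zero_iff, ProjectiveResolution.mk₀_comp_extMk (φ := φ), extMk_eq_zero_iff_exists]

end DerivedExt

section LocalCohomology

variable {R : Type u} [CommRing R]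

/-- The projection `R / 𝔟 ⟶ R / 𝔠` for ideals `𝔟 ≤ 𝔠`. -/
noncomputable abbrev quotientMap {𝔟 𝔠 : Ideal R} (h : 𝔟 ≤ 𝔠) :
    ModuleCat.of R (R ⧸ 𝔟) ⟶ ModuleCat.of R (R ⧸ 𝔠) :=
  ModuleCat.ofHom (Submodule.mapQ 𝔟 𝔠 LinearMap.id h)

/-- Local cohomology vanishes if and only if each class in `Ext^i(R / I^n, M)` restricts to zero in
`Ext^i(R / I^m, M)` for some `m ≥ n`. -/
theorem isZero_localCohomology_iff (I : Ideal R) (i : ℕ) (M : ModuleCat.{u} R) :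
    IsZero ((localCohomology I i).obj M) ↔
      ∀ (n : ℕ) (x : Abelian.Ext (ModuleCat.of R (R ⧸ I ^ n)) M i), ∃ (m : ℕ) (h : n ≤ m),
        (Abelian.Ext.mk₀ (quotientMap (Ideal.pow_le_pow_right (I := I) h))).comp x
          (zero_add i) = 0 := by
  let D := localCohomology.diagram (localCohomology.idealPowersDiagram I) i ⋙
    (evaluation _ _).obj M
  have e : (localCohomology I i).obj M ≅ colimit D := by
    have := localCohomology.hasColimitDiagram.{u, 0} (localCohomology.idealPowersDiagram I) i
    exact colimitObjIsoColimitCompEvaluation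
      (localCohomology.diagram (localCohomology.idealPowersDiagram I) i) M
  have : IsFiltered ℕᵒᵖᵒᵖ := IsFiltered.of_equivalence (opOpEquivalence ℕ).symm
  have : PreservesFilteredColimitsOfSize.{0, 0} (forget (ModuleCat.{u} R)) :=
    preservesFilteredColimitsOfSize_shrink.{0, u, 0, u} _
  have key : IsZero ((localCohomology I i).obj M) ↔ ∀ (n : ℕ) (x : D.obj (op (op n))),
      ∃ (m : ℕ) (h : n ≤ m), (D.map (homOfLE h).op.op).hom x = 0 := by
    rw [e.isZero_iff, ModuleCat.isZero_iff_subsingleton]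
    constructor
    · intro hs n x
      have h0 : (colimit.ι D (op (op n))).hom x = (colimit.ι D (op (op n))).hom 0 :=
        Subsingleton.elim _ _
      obtain ⟨m, f, g, hfg⟩ := Concrete.colimit_exists_of_rep_eq D x 0 h0
      have hg : (D.map g).hom (0 : D.obj (op (op n))) = 0 := map_zero _
      exact ⟨m.unop.unop, leOfHom f.unop.unop, hfg.trans hg⟩
    · intro h
      refine ⟨fun a b => ?_⟩
      have hz (a : (colimit D : ModuleCat.{u} R)) : a = 0 := by
        obtain ⟨j, x, rfl⟩ := Concrete.colimit_exists_rep D a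
        obtain ⟨m, hm, hx⟩ := h j.unop.unop x
        have := congrArg (fun φ => φ.hom x) (colimit.w D (homOfLE hm).op.op)
        refine this.symm.trans ?_
        change (colimit.ι D _).hom ((D.map (homOfLE hm).op.op).hom x) = 0
        rw [hx, map_zero]
      exact (hz a).trans (hz b).symm
  rw [key]
  have hP (n : ℕ) : ∃ P : ProjectiveResolution (ModuleCat.of R (R ⧸ I ^ n)), True :=
    ⟨projectiveResolution _, trivial⟩
  choose P _ using hP
  constructor
  · intro h n x
    obtain ⟨f, hf, rfl⟩ := (P n).extMk_surjective x (i + 1) rfl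
    obtain ⟨e, he⟩ := exists_represents_of_comp_eq_zero (R := R) (P n) f hf
    obtain ⟨m, hm, h0⟩ := h n e
    exact ⟨m, hm, (map_eq_zero_iff_of_represents (P n) (P m) he _).1 h0⟩
  · intro h n e
    obtain ⟨f, he⟩ := exists_represents (P n) e
    obtain ⟨m, hm, h0⟩ := h n ((P n).extMk f (i + 1) rfl he.comp_eq_zero)
    exact ⟨m, hm, (map_eq_zero_iff_of_represents (P n) (P m) he _).2 h0⟩

end LocalCohomology

/-! ### Vanishing of local cohomology and exact sequences -/

section Vanishing

variable {R : Type u} [CommRing R]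

/-- The local cohomology module `H^i_I(M)` is zero. -/
def Vanishes (I : Ideal R) (i : ℕ) (M : Type u) [AddCommGroup M] [Module R M] : Prop :=
  IsZero ((localCohomology I i).obj (ModuleCat.of R M))

variable {I : Ideal R} {i : ℕ} {M N L : Type u} [AddCommGroup M] [Module R M] [AddCommGroup N]
  [Module R N] [AddCommGroup L] [Module R L]

/-- The short exact sequence `0 ⟶ M ⟶ N ⟶ L ⟶ 0` as a short complex of objects of `ModuleCat R`. -/
abbrev shortComplexOfExact (f : M →ₗ[R] N) (g : N →ₗ[R] L) (hfg : Function.Exact f g) :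
    ShortComplex (ModuleCat.{u} R) :=
  ShortComplex.mk (ModuleCat.ofHom f) (ModuleCat.ofHom g) (by
    ext x; exact hfg.apply_apply_eq_zero x)

theorem shortExact_shortComplexOfExact {f : M →ₗ[R] N} {g : N →ₗ[R] L} (hf : Function.Injective f)
    (hfg : Function.Exact f g) (hg : Function.Surjective g) :
    (shortComplexOfExact f g hfg).ShortExact where
  exact := (ShortComplex.ShortExact.moduleCat_exact_iff_function_exact _).2 hfg
  mono_f := (ModuleCat.mono_iff_injective _).2 hf
  epi_g := (ModuleCat.epi_iff_surjective _).2 hg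

/-- Restriction of extensions of `R / I ^ n` along `R / I ^ m ⟶ R / I ^ n`. -/
noncomputable def restrict {X : ModuleCat.{u} R} {n m : ℕ} (h : n ≤ m)
    (x : Abelian.Ext (ModuleCat.of R (R ⧸ I ^ n)) X i) :
    Abelian.Ext (ModuleCat.of R (R ⧸ I ^ m)) X i :=
  (Abelian.Ext.mk₀ (quotientMap (Ideal.pow_le_pow_right (I := I) h))).comp x (zero_add i)

theorem restrict_zero {X : ModuleCat.{u} R} {n m : ℕ} (h : n ≤ m) :
    restrict h (0 : Abelian.Ext (ModuleCat.of R (R ⧸ I ^ n)) X i) = 0 := by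
  simp [restrict]

theorem restrict_restrict {X : ModuleCat.{u} R} {n m l : ℕ} (h : n ≤ m) (h' : m ≤ l)
    (x : Abelian.Ext (ModuleCat.of R (R ⧸ I ^ n)) X i) :
    restrict h' (restrict h x) = restrict (h.trans h') x := by
  rw [restrict, restrict, Abelian.Ext.mk₀_comp_mk₀_assoc, restrict]
  congr 2
  ext
  rfl

theorem restrict_comp {X Y : ModuleCat.{u} R} {n m j k : ℕ} (h : n ≤ m)
    (x : Abelian.Ext (ModuleCat.of R (R ⧸ I ^ n)) X i) (y : Abelian.Ext X Y j) (hk : i + j = k) :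
    (restrict h x).comp y hk = restrict h (x.comp y hk) :=
  Abelian.Ext.comp_assoc _ _ _ _ _ (by lia)

theorem vanishes_iff : Vanishes I i M ↔
    ∀ (n : ℕ) (x : Abelian.Ext (ModuleCat.of R (R ⧸ I ^ n)) (ModuleCat.of R M) i),
      ∃ (m : ℕ) (h : n ≤ m), restrict h x = 0 :=
  isZero_localCohomology_iff I i (ModuleCat.of R M)

theorem Vanishes.of_retract (h : Vanishes I i M) (f : N →ₗ[R] M) (g : M →ₗ[R] N)
    (hgf : ∀ x, g (f x) = x) : Vanishes I i N := by
  have hid : ModuleCat.ofHom f ≫ ModuleCat.ofHom g = 𝟙 (ModuleCat.of R N) := by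
    ext x; exact hgf x
  refine (IsZero.iff_id_eq_zero _).2 ?_
  rw [← CategoryTheory.Functor.map_id, ← hid, Functor.map_comp,
    IsZero.eq_zero_of_tgt h ((localCohomology I i).map (ModuleCat.ofHom f)), zero_comp]

theorem Vanishes.congr (h : Vanishes I i M) (e : M ≃ₗ[R] N) : Vanishes I i N :=
  h.of_retract e.symm.toLinearMap e.toLinearMap (by simp)

variable {f : M →ₗ[R] N} {g : N →ₗ[R] L}

theorem Vanishes.middle (hM : Vanishes I i M) (hL : Vanishes I i L) (hf : Function.Injective f)
    (hfg : Function.Exact f g) (hg : Function.Surjective g) : Vanishes I i N := by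
  have hS := shortExact_shortComplexOfExact hf hfg hg
  rw [vanishes_iff] at hM hL ⊢
  intro n x
  obtain ⟨m, hm, h1⟩ := hL n (x.comp (Abelian.Ext.mk₀ (ModuleCat.ofHom g)) (add_zero i))
  rw [← restrict_comp] at h1
  obtain ⟨y, hy⟩ := Abelian.Ext.covariant_sequence_exact₂ _ hS _ h1
  obtain ⟨l, hl, h2⟩ := hM m y
  refine ⟨l, hm.trans hl, ?_⟩
  rw [← restrict_restrict hm hl, ← hy, ← restrict_comp, h2, Abelian.Ext.zero_comp]

theorem Vanishes.right (hN : Vanishes I i N) (hM : Vanishes I (i + 1) M)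
    (hf : Function.Injective f) (hfg : Function.Exact f g) (hg : Function.Surjective g) :
    Vanishes I i L := by
  have hS := shortExact_shortComplexOfExact hf hfg hg
  rw [vanishes_iff] at hM hN ⊢
  intro n x
  obtain ⟨m, hm, h1⟩ := hM n (x.comp hS.extClass rfl)
  rw [← restrict_comp] at h1
  obtain ⟨y, hy⟩ := Abelian.Ext.covariant_sequence_exact₃ _ hS _ _ h1
  obtain ⟨l, hl, h2⟩ := hN m y
  refine ⟨l, hm.trans hl, ?_⟩
  rw [← restrict_restrict hm hl, ← hy, ← restrict_comp, h2, Abelian.Ext.zero_comp]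

theorem Vanishes.left (hL : Vanishes I i L) (hN : Vanishes I (i + 1) N)
    (hf : Function.Injective f) (hfg : Function.Exact f g) (hg : Function.Surjective g) :
    Vanishes I (i + 1) M := by
  have hS := shortExact_shortComplexOfExact hf hfg hg
  rw [vanishes_iff] at hL hN ⊢
  intro n x
  obtain ⟨m, hm, h1⟩ := hN n (x.comp (Abelian.Ext.mk₀ (ModuleCat.ofHom f)) (add_zero _))
  rw [← restrict_comp] at h1
  obtain ⟨y, hy⟩ := Abelian.Ext.covariant_sequence_exact₁ _ hS _ h1 rfl
  obtain ⟨l, hl, h2⟩ := hL m y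
  refine ⟨l, hm.trans hl, ?_⟩
  rw [← restrict_restrict hm hl, ← hy, ← restrict_comp, h2, Abelian.Ext.zero_comp]

/-- `H^0_I(M)` is the submodule of elements killed by a power of `I`. -/
theorem vanishes_zero_iff : Vanishes I 0 M ↔
    ∀ (n : ℕ) (m : M), (∀ a ∈ I ^ n, a • m = 0) → m = 0 := by
  rw [vanishes_iff]
  constructor
  · intro h n m hm
    let φ : (R ⧸ I ^ n) →ₗ[R] M := Submodule.liftQ (I ^ n) (LinearMap.toSpanSingleton R M m) hm
    obtain ⟨l, hl, h0⟩ := h n (Abelian.Ext.mk₀ (ModuleCat.ofHom φ))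
    rw [restrict, Abelian.Ext.mk₀_comp_mk₀, Abelian.Ext.mk₀_eq_zero_iff] at h0
    have := congrArg (fun ψ => ψ.hom (Submodule.Quotient.mk 1)) h0
    exact (one_smul R m).symm.trans this
  · intro h n x
    refine ⟨n, le_rfl, ?_⟩
    obtain ⟨φ, rfl⟩ := (Abelian.Ext.mk₀_bijective _ _).2 x
    have hφ : φ = 0 := by
      ext
      refine h n _ fun a ha => ?_
      change a • φ.hom (Submodule.Quotient.mk 1) = 0
      rw [← map_smul, ← Submodule.Quotient.mk_smul,
        (Submodule.Quotient.mk_eq_zero _).2 (by simpa using ha), map_zero]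
    rw [hφ, Abelian.Ext.mk₀_zero, restrict_zero]

theorem Vanishes.zero_of_injective (hN : Vanishes I 0 N) (hf : Function.Injective f) :
    Vanishes I 0 M := by
  rw [vanishes_zero_iff] at hN ⊢
  refine fun n m hm => hf ?_
  rw [map_zero]
  exact hN n _ fun a ha => by rw [← map_smul, hm a ha, map_zero]

/-- If the identity of `M` is a combination of endomorphisms with coefficients in `I`, then the
local cohomology of `M` vanishes: then so is the identity with coefficients in `I ^ n`, and `I ^ n`
kills `Ext^i(R / I ^ n, M)`. -/
theorem vanishes_of_one_mem (h : (1 : Module.End R M) ∈ I • (⊤ : Submodule R (Module.End R M)))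
    (i : ℕ) : Vanishes I i M := by
  have hpow (n : ℕ) : (1 : Module.End R M) ∈ I ^ n • (⊤ : Submodule R (Module.End R M)) := by
    induction n with
    | zero => simp
    | succ n ih =>
      have hle : I • (⊤ : Submodule R (Module.End R M)) ≤
          I ^ (n + 1) • (⊤ : Submodule R (Module.End R M)) := by
        refine Submodule.smul_le.2 fun a ha φ _ => ?_
        have : φ ∈ I ^ n • (⊤ : Submodule R (Module.End R M)) := by
          rw [← mul_one φ]
          refine Submodule.smul_induction_on
            (p := fun ψ => φ * ψ ∈ I ^ n • (⊤ : Submodule R (Module.End R M))) ih ?_ ?_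
          · intro r hr ψ _
            rw [mul_smul_comm]
            exact Submodule.smul_mem_smul hr trivial
          · intro ψ ψ' h h'
            rw [mul_add]
            exact add_mem h h'
        rw [pow_succ', Submodule.mul_smul]
        exact Submodule.smul_mem_smul ha this
      exact hle h
  rw [vanishes_iff]
  refine fun n x => ⟨n, le_rfl, ?_⟩
  have hx (a : R) (ha : a ∈ I ^ n) : a • x = 0 := by
    have h0 : a • 𝟙 (ModuleCat.of R (R ⧸ I ^ n)) = 0 := by
      ext
      change a • (Submodule.Quotient.mk 1 : R ⧸ I ^ n) = 0
      rw [← Submodule.Quotient.mk_smul, (Submodule.Quotient.mk_eq_zero _).2 (by simpa using ha)]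
    have := Abelian.Ext.smul_comp (Abelian.Ext.mk₀ (𝟙 (ModuleCat.of R (R ⧸ I ^ n)))) x
      (zero_add i) a
    rw [Abelian.Ext.mk₀_id_comp, ← Abelian.Ext.mk₀_smul, h0, Abelian.Ext.mk₀_zero,
      Abelian.Ext.zero_comp] at this
    exact this.symm
  have hφ (φ : Module.End R M) (hφ : φ ∈ I ^ n • (⊤ : Submodule R (Module.End R M))) :
      x.comp (Abelian.Ext.mk₀ (ModuleCat.ofHom φ)) (add_zero i) = 0 := by
    refine Submodule.smul_induction_on hφ ?_ ?_
    · intro a ha ψ _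
      have : ModuleCat.ofHom (a • ψ) = a • ModuleCat.ofHom ψ := rfl
      rw [this, Abelian.Ext.mk₀_smul, Abelian.Ext.comp_smul, ← Abelian.Ext.smul_comp, hx a ha,
        Abelian.Ext.zero_comp]
    · intro ψ ψ' h h'
      have : ModuleCat.ofHom (ψ + ψ') = ModuleCat.ofHom ψ + ModuleCat.ofHom ψ' := rfl
      rw [this, Abelian.Ext.mk₀_add, Abelian.Ext.comp_add, h, h', add_zero]
  have := hφ 1 (hpow n)
  have h1 : ModuleCat.ofHom (1 : Module.End R M) = 𝟙 (ModuleCat.of R M) := rfl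
  rw [h1, Abelian.Ext.comp_mk₀_id] at this
  rw [this, restrict_zero]

end Vanishing

/-! ### Torsion modules -/

section Torsion

variable {R : Type u} [CommRing R]

/-- The `I`-torsion submodule of `M`: the elements killed by some power of each element of `I`. For
finitely generated `I` these are the elements killed by a power of `I`. -/
def torsionSubmodule (I : Ideal R) (M : Type v) [AddCommGroup M] [Module R M] :
    Submodule R M where
  carrier := {m | ∀ a ∈ I, ∃ n : ℕ, a ^ n • m = 0}
  zero_mem' := fun _ _ => ⟨0, smul_zero _⟩
  add_mem' := by
    intro x y hx hy a ha
    obtain ⟨n, hn⟩ := hx a ha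
    obtain ⟨m, hm⟩ := hy a ha
    refine ⟨n + m, ?_⟩
    rw [smul_add, pow_add, mul_smul _ _ y, hm, smul_zero, add_zero, mul_comm, mul_smul, hn,
      smul_zero]
  smul_mem' := by
    intro c x hx a ha
    obtain ⟨n, hn⟩ := hx a ha
    exact ⟨n, by rw [smul_comm, hn, smul_zero]⟩

/-- Each element of `M` is `I`-torsion. -/
def IsTorsion (I : Ideal R) (M : Type v) [AddCommGroup M] [Module R M] : Prop :=
  ∀ m : M, m ∈ torsionSubmodule I M

theorem isTorsion_torsionSubmodule (I : Ideal R) (M : Type v) [AddCommGroup M] [Module R M] :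
    IsTorsion I (torsionSubmodule I M) := fun m a ha => by
  obtain ⟨n, hn⟩ := m.2 a ha
  exact ⟨n, Subtype.ext hn⟩

variable [IsNoetherianRing R] {I : Ideal R}

theorem exists_pow_smul_eq_zero {M : Type v} [AddCommGroup M] [Module R M] {m : M}
    (hm : m ∈ torsionSubmodule I M) : ∃ n : ℕ, ∀ a ∈ I ^ n, a • m = 0 := by
  obtain ⟨n, hn⟩ := Ideal.exists_pow_le_of_le_radical_of_fg
    (J := LinearMap.ker (LinearMap.toSpanSingleton R M m)) (I := I)
    (fun a ha => (hm a ha).imp fun n hn => by simpa using hn) (IsNoetherian.noetherian I)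
  exact ⟨n, fun a ha => by simpa using hn ha⟩

variable {M : Type u} [AddCommGroup M] [Module R M]

theorem vanishes_zero_iff_torsionSubmodule : Vanishes I 0 M ↔ torsionSubmodule I M = ⊥ := by
  rw [vanishes_zero_iff, eq_bot_iff]
  constructor
  · intro h m hm
    obtain ⟨n, hn⟩ := exists_pow_smul_eq_zero hm
    exact h n m hn
  · intro h n m hm
    exact h fun a ha => ⟨n, hm _ (Ideal.pow_mem_pow ha n)⟩

theorem torsionSubmodule_quotient_eq_bot :
    torsionSubmodule I (M ⧸ torsionSubmodule I M) = ⊥ := by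
  rw [eq_bot_iff]
  intro x hx
  obtain ⟨m, rfl⟩ := Submodule.Quotient.mk_surjective _ x
  obtain ⟨n, hn⟩ := exists_pow_smul_eq_zero hx
  refine (Submodule.Quotient.mk_eq_zero _).2 fun a ha => ?_
  have h1 := hn _ (Ideal.pow_mem_pow ha n)
  rw [← Submodule.Quotient.mk_smul, Submodule.Quotient.mk_eq_zero] at h1
  obtain ⟨l, hl⟩ := h1 a ha
  exact ⟨l + n, by rw [pow_add, mul_smul, hl]⟩

/-- A linear map from a finitely generated module to a torsion module is zero on `I ^ n • ⊤` for
large `n`. -/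
theorem exists_pow_smul_le_ker {P : Type v} [AddCommGroup P] [Module R P] [Module.Finite R P]
    (hM : IsTorsion I M) (φ : P →ₗ[R] M) :
    ∃ n : ℕ, I ^ n • (⊤ : Submodule R P) ≤ LinearMap.ker φ := by
  obtain ⟨s, hs⟩ := Module.Finite.fg_top (R := R) (M := P)
  choose n hn using fun p : P => exists_pow_smul_eq_zero (hM (φ p))
  refine ⟨s.sup n, ?_⟩
  rw [← hs, Submodule.smul_le]
  intro a ha p hp
  rw [LinearMap.mem_ker, map_smul]
  induction hp using Submodule.span_induction with
  | mem x hx => exact hn x a (Ideal.pow_le_pow_right (Finset.le_sup hx) ha)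
  | zero => simp
  | add x y _ _ h h' => rw [map_add, smul_add, h, h', add_zero]
  | smul c x _ h => rw [map_smul, smul_comm, h, smul_zero]

/-- If `P` is finitely generated and `M` is `I`-torsion, then a class in `Ext^i(P, M)` is zero
after restriction to `I ^ m • P` for large `m`. By induction on `i`: with `0 ⟶ K ⟶ F ⟶ P ⟶ 0`
exact and `F` free, the class comes from `Ext^(i-1)(K, M)`, and the subspace topology of `K ≤ F` is
the `I`-adic one by the Artin-Rees lemma. -/
theorem exists_comp_eq_zero_of_isTorsion (hM : IsTorsion I M) (i : ℕ) :
    ∀ (P : Type u) [AddCommGroup P] [Module R P] [Module.Finite R P]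
      (x : Abelian.Ext (ModuleCat.of R P) (ModuleCat.of R M) i),
      ∃ m : ℕ, ∀ (Q : Type u) [AddCommGroup Q] [Module R Q] (j : Q →ₗ[R] P),
        LinearMap.range j ≤ I ^ m • ⊤ →
          (Abelian.Ext.mk₀ (ModuleCat.ofHom j)).comp x (zero_add i) = 0 := by
  induction i with
  | zero =>
    intro P _ _ _ x
    obtain ⟨φ, rfl⟩ := (Abelian.Ext.mk₀_bijective _ _).2 x
    obtain ⟨n, hn⟩ := exists_pow_smul_le_ker hM φ.hom
    refine ⟨n, fun Q _ _ j hj => ?_⟩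
    rw [Abelian.Ext.mk₀_comp_mk₀, Abelian.Ext.mk₀_eq_zero_iff]
    ext q
    exact hn (hj ⟨q, rfl⟩)
  | succ i ih =>
    intro P _ _ _ x
    obtain ⟨r, π, hπ⟩ := Module.Finite.exists_fin' R P
    -- `F` is free of rank `r`, in the universe of `R`
    obtain ⟨F, _, _, _, _, π, hπ⟩ : ∃ (F : Type u) (_ : AddCommGroup F) (_ : Module R F)
        (_ : Module.Finite R F) (_ : Module.Free R F) (π : F →ₗ[R] P), Function.Surjective π :=
      ⟨Fin r → R, inferInstance, inferInstance, inferInstance, inferInstance, π, hπ⟩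
    have hS := LinearMap.shortExact_shortComplexKer hπ
    have : Projective (ModuleCat.of R F) :=
      (IsProjective.iff_projective F).1 inferInstance
    obtain ⟨y, hy⟩ := Abelian.Ext.contravariant_sequence_exact₃ hS _ x
      (Abelian.Ext.eq_zero_of_projective _) (add_comm 1 i)
    obtain ⟨t, ht⟩ := ih (LinearMap.ker π) y
    obtain ⟨k, hk⟩ := Ideal.exists_pow_inf_eq_pow_smul I (LinearMap.ker π)
    have hm : I ^ (t + k) • ⊤ ⊓ LinearMap.ker π ≤ I ^ t • LinearMap.ker π := by
      rw [hk (t + k) (by lia), Nat.add_sub_cancel]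
      exact smul_mono_right _ inf_le_right
    let F' : Submodule R F := I ^ (t + k) • ⊤
    let P' : Submodule R P := I ^ (t + k) • ⊤
    have hF' : F'.map π = P' := by
      rw [Submodule.map_smul'', Submodule.map_top, LinearMap.range_eq_top.2 hπ]
    let π' : F' →ₗ[R] P' := π.restrict fun a ha => hF' ▸ Submodule.mem_map_of_mem ha
    have hπ' : Function.Surjective π' := by
      rintro ⟨p, hp⟩
      rw [← hF'] at hp
      obtain ⟨a, ha, rfl⟩ := hp
      exact ⟨⟨a, ha⟩, rfl⟩
    have hS' := LinearMap.shortExact_shortComplexKer hπ'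
    let ι : LinearMap.ker π' →ₗ[R] LinearMap.ker π :=
      F'.subtype.restrict fun a ha => by
        simpa [π'] using congrArg Subtype.val (LinearMap.mem_ker.1 ha)
    have hι : LinearMap.range ι ≤ I ^ t • ⊤ := by
      rintro _ ⟨a, rfl⟩
      exact (Submodule.mem_smul_top_iff _ _ _).2 (hm ⟨a.1.2, (ι a).2⟩)
    let τ : π'.shortComplexKer ⟶ π.shortComplexKer :=
      { τ₁ := ModuleCat.ofHom ι
        τ₂ := ModuleCat.ofHom F'.subtype
        τ₃ := ModuleCat.ofHom P'.subtype
        comm₁₂ := rfl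
        comm₂₃ := rfl }
    have h0 : (Abelian.Ext.mk₀ (ModuleCat.ofHom P'.subtype)).comp x (zero_add _) = 0 := by
      have hnat := ShortComplex.ShortExact.extClass_naturality hS' hS τ
      rw [← hy, ← Abelian.Ext.comp_assoc (a₁₂ := 1) _ _ _ (by lia) (by lia) (by lia)]
      change ((Abelian.Ext.mk₀ τ.τ₃).comp hS.extClass _).comp y _ = 0
      rw [← hnat, Abelian.Ext.comp_assoc (a₂₃ := i) _ _ _ (by lia) (by lia) (by lia)]
      change hS'.extClass.comp ((Abelian.Ext.mk₀ (ModuleCat.ofHom ι)).comp y _) _ = 0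
      rw [ht _ ι hι, Abelian.Ext.comp_zero]
    refine ⟨t + k, fun Q _ _ j hj => ?_⟩
    have hj' : ModuleCat.ofHom j = ModuleCat.ofHom (j.codRestrict P' fun q => hj ⟨q, rfl⟩) ≫
        ModuleCat.ofHom P'.subtype := rfl
    rw [hj', ← Abelian.Ext.mk₀_comp_mk₀_assoc, h0, Abelian.Ext.comp_zero]

/-- The higher local cohomology of an `I`-torsion module vanishes. -/
theorem IsTorsion.vanishes_succ (hM : IsTorsion I M) (i : ℕ) : Vanishes I (i + 1) M := by
  rw [vanishes_iff]
  intro n x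
  have hS (n : ℕ) := LinearMap.shortExact_shortComplexKer (Submodule.mkQ_surjective (I ^ n))
  have : Projective (ModuleCat.of R R) := (IsProjective.iff_projective R).1 inferInstance
  obtain ⟨y, hy⟩ := Abelian.Ext.contravariant_sequence_exact₃ (hS n) _ x
      (Abelian.Ext.eq_zero_of_projective _) (add_comm 1 i)
  obtain ⟨t, ht⟩ := exists_comp_eq_zero_of_isTorsion hM i (LinearMap.ker (I ^ n).mkQ) y
  have hle : I ^ (n + t) ≤ I ^ n := Ideal.pow_le_pow_right (by lia)
  let ι : LinearMap.ker (I ^ (n + t)).mkQ →ₗ[R] LinearMap.ker (I ^ n).mkQ :=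
    Submodule.inclusion (by simpa using hle)
  have hι : LinearMap.range ι ≤ I ^ t • ⊤ := by
    rintro _ ⟨a, rfl⟩
    have hle' : I ^ (n + t) ≤ I ^ t • LinearMap.ker (I ^ n).mkQ := by
      rw [Submodule.ker_mkQ, smul_eq_mul, ← pow_add, add_comm]
    exact (Submodule.mem_smul_top_iff _ _ _).2 (hle' ((Submodule.ker_mkQ (I ^ (n + t))).le a.2))
  let τ : (I ^ (n + t)).mkQ.shortComplexKer ⟶ (I ^ n).mkQ.shortComplexKer :=
    { τ₁ := ModuleCat.ofHom ι
      τ₂ := 𝟙 _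
      τ₃ := quotientMap hle
      comm₁₂ := rfl
      comm₂₃ := rfl }
  refine ⟨n + t, by lia, ?_⟩
  have hnat := ShortComplex.ShortExact.extClass_naturality (hS (n + t)) (hS n) τ
  rw [← hy, restrict, ← Abelian.Ext.comp_assoc (a₁₂ := 1) _ _ _ (by lia) (by lia) (by lia)]
  change ((Abelian.Ext.mk₀ τ.τ₃).comp (hS n).extClass _).comp y _ = 0
  rw [← hnat, Abelian.Ext.comp_assoc (a₂₃ := i) _ _ _ (by lia) (by lia) (by lia)]
  change (hS (n + t)).extClass.comp ((Abelian.Ext.mk₀ (ModuleCat.ofHom ι)).comp y _) _ = 0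
  rw [ht _ ι hι, Abelian.Ext.comp_zero]

end Torsion

/-! ### Dimension shifting along localizations -/

section Cover

variable {R : Type u} [CommRing R]

/-- The identity of `X` is a combination of endomorphisms with coefficients in `F`. This holds for a
product of modules on each of which some element of `F` is invertible. -/
def IsCovered (F : Finset R) (X : Type v) [AddCommGroup X] [Module R X] : Prop :=
  ∃ ψ : F → Module.End R X, ∑ f : F, (f : R) • ψ f = 1

theorem IsCovered.vanishes {F : Finset R} {I : Ideal R} (hF : (F : Set R) ⊆ I) {X : Type u}
    [AddCommGroup X] [Module R X] (hX : IsCovered F X) (i : ℕ) : Vanishes I i X := by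
  obtain ⟨ψ, hψ⟩ := hX
  refine vanishes_of_one_mem ?_ i
  rw [← hψ]
  exact Submodule.sum_mem _ fun f _ => Submodule.smul_mem_smul (hF f.2) trivial

/-- The map from `M` to the product of its localizations at the elements of `F` has torsion
kernel. -/
theorem exists_cover {F : Finset R} {I : Ideal R} (hI : I ≤ (Ideal.span (F : Set R)).radical)
    (M : Type u) [AddCommGroup M] [Module R M] :
    ∃ (X : ModuleCat.{u} R) (φ : M →ₗ[R] X), IsCovered F X ∧
      LinearMap.ker φ ≤ torsionSubmodule I M := by
  classical
  let Y (f : F) := LocalizedModule (Submonoid.powers (f : R)) M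
  let φ (f : F) : M →ₗ[R] Y f := LocalizedModule.mkLinearMap _ M
  have hu (f : F) : IsUnit (algebraMap R (Module.End R (Y f)) f) :=
    IsLocalizedModule.map_units (φ f) ⟨(f : R), Submonoid.mem_powers _⟩
  choose u hu using hu
  refine ⟨ModuleCat.of R (∀ f, Y f), LinearMap.pi φ, ⟨fun f =>
    LinearMap.single R Y f ∘ₗ (↑(u f)⁻¹ : Module.End R (Y f)) ∘ₗ LinearMap.proj f, ?_⟩, ?_⟩
  · refine LinearMap.ext fun x => funext fun f => ?_
    have h1 (y : Y f) : (f : R) • (↑(u f)⁻¹ : Module.End R (Y f)) y = y := by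
      have := congrArg (fun φ : Module.End R (Y f) => φ y) (u f).mul_inv
      rwa [hu f] at this
    rw [LinearMap.sum_apply, Finset.sum_apply, Finset.sum_eq_single f]
    · simpa using h1 (x f)
    · intro g _ hgf
      simp [Pi.single_eq_of_ne hgf.symm]
    · simp
  · intro m hm
    have hle : I ≤ Ideal.radical (LinearMap.ker (LinearMap.toSpanSingleton R M m)) := by
      refine hI.trans (Ideal.radical_le_radical_iff.2 (Ideal.span_le.2 fun f hf => ?_))
      have h0 : φ ⟨f, hf⟩ m = 0 := congrFun (LinearMap.mem_ker.1 hm) ⟨f, hf⟩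
      obtain ⟨⟨_, n, rfl⟩, hn⟩ := (IsLocalizedModule.eq_zero_iff (Submonoid.powers f) _).1 h0
      exact ⟨n, by simpa using! hn⟩
    intro a ha
    obtain ⟨n, hn⟩ := hle ha
    exact ⟨n, by simpa using hn⟩

end Cover

section Transfer

variable {R : Type u} [CommRing R] {A : Type w} [CommRing A]

/-- An exact functor that takes `I`-torsion modules to `𝔞`-torsion modules. -/
structure IsExactTorsion (G : ModuleCat.{u} R ⥤ ModuleCat.{w} A) (I : Ideal R) (𝔞 : Ideal A) :
    Prop where
  injective {M N : ModuleCat.{u} R} (f : M ⟶ N) :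
    Function.Injective f.hom → Function.Injective (G.map f).hom
  exact {M N L : ModuleCat.{u} R} (f : M ⟶ N) (g : N ⟶ L) :
    Function.Exact f.hom g.hom → Function.Surjective g.hom →
      Function.Exact (G.map f).hom (G.map g).hom
  surjective {M N : ModuleCat.{u} R} (f : M ⟶ N) :
    Function.Surjective f.hom → Function.Surjective (G.map f).hom
  isTorsion (M : ModuleCat.{u} R) : IsTorsion I M → IsTorsion 𝔞 (G.obj M)

variable {I : Ideal R} {𝔞 : Ideal A} {G : ModuleCat.{u} R ⥤ ModuleCat.{w} A} {i c d : ℕ}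
  {F : Finset R}

section

variable [IsNoetherianRing R]

theorem vanishes_quotient_range {M Y : Type u} [AddCommGroup M] [Module R M] [AddCommGroup Y]
    [Module R Y] {φ : M →ₗ[R] Y} (hφ : LinearMap.ker φ ≤ torsionSubmodule I M)
    (hM : Vanishes I (i + 1) M) (hY : Vanishes I i Y) : Vanishes I i (Y ⧸ LinearMap.range φ) := by
  have hK : IsTorsion I (LinearMap.ker φ) := fun m a ha => by
    obtain ⟨n, hn⟩ := hφ m.2 a ha
    exact ⟨n, Subtype.ext hn⟩
  have hr : Vanishes I (i + 1) (LinearMap.range φ) :=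
    hM.right (hK.vanishes_succ _) (LinearMap.ker φ).injective_subtype
      (by rw [LinearMap.exact_iff, LinearMap.ker_rangeRestrict, Submodule.range_subtype])
      φ.surjective_rangeRestrict
  exact hY.right hr (LinearMap.range φ).injective_subtype
    (LinearMap.exact_subtype_mkQ _) (Submodule.mkQ_surjective _)

end

theorem IsExactTorsion.vanishes_of_quotient_range [IsNoetherianRing A]
    (hG : IsExactTorsion G I 𝔞) {M Y : Type u} [AddCommGroup M]
    [Module R M] [AddCommGroup Y] [Module R Y] {φ : M →ₗ[R] Y}
    (hφ : LinearMap.ker φ ≤ torsionSubmodule I M)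
    (hQ : Vanishes 𝔞 i (G.obj (ModuleCat.of R (Y ⧸ LinearMap.range φ))))
    (hY : Vanishes 𝔞 (i + 1) (G.obj (ModuleCat.of R Y))) :
    Vanishes 𝔞 (i + 1) (G.obj (ModuleCat.of R M)) := by
  have hK : IsTorsion I (LinearMap.ker φ) := fun m a ha => by
    obtain ⟨n, hn⟩ := hφ m.2 a ha
    exact ⟨n, Subtype.ext hn⟩
  have hr : Vanishes 𝔞 (i + 1) (G.obj (ModuleCat.of R (LinearMap.range φ))) :=
    hQ.left hY (hG.injective (ModuleCat.ofHom (LinearMap.range φ).subtype)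
      (LinearMap.range φ).injective_subtype)
      (hG.exact _ (ModuleCat.ofHom (LinearMap.range φ).mkQ)
        (LinearMap.exact_subtype_mkQ _) (Submodule.mkQ_surjective _))
      (hG.surjective _ (Submodule.mkQ_surjective _))
  exact Vanishes.middle ((hG.isTorsion _ hK).vanishes_succ i) hr
    (hG.injective (ModuleCat.ofHom (LinearMap.ker φ).subtype) (LinearMap.ker φ).injective_subtype)
    (hG.exact _ (ModuleCat.ofHom φ.rangeRestrict)
      (by
        change Function.Exact (LinearMap.ker φ).subtype φ.rangeRestrict
        rw [LinearMap.exact_iff, LinearMap.ker_rangeRestrict, Submodule.range_subtype])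
      φ.surjective_rangeRestrict)
    (hG.surjective _ φ.surjective_rangeRestrict)

variable [IsNoetherianRing R] [IsNoetherianRing A]

/-- If an exact functor takes products of localizations to modules without local cohomology, it does
so with all modules without local cohomology: such a module `Z` embeds into a product `X` of
localizations with a quotient of the same kind, so that the vanishing for `Z` in degree `i` follows
from that for `X / Z` in degree `i - 1`. -/
theorem IsExactTorsion.vanishes_of_forall_vanishes (hG : IsExactTorsion G I 𝔞)
    (hF : (F : Set R) ⊆ I) (hI : I ≤ (Ideal.span (F : Set R)).radical)
    (hX : ∀ X : ModuleCat.{u} R, IsCovered F X → ∀ i, Vanishes 𝔞 i (G.obj X)) (i : ℕ) :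
    ∀ Z : ModuleCat.{u} R, (∀ i, Vanishes I i Z) → Vanishes 𝔞 i (G.obj Z) := by
  induction i with
  | zero =>
    intro Z hZ
    obtain ⟨X, φ, hXF, hφ⟩ := exists_cover hI Z
    rw [vanishes_zero_iff_torsionSubmodule.1 (hZ 0), le_bot_iff, LinearMap.ker_eq_bot] at hφ
    exact (hX X hXF 0).zero_of_injective (hG.injective (ModuleCat.ofHom φ) hφ)
  | succ i ih =>
    intro Z hZ
    obtain ⟨X, φ, hXF, hφ⟩ := exists_cover hI Z
    exact hG.vanishes_of_quotient_range hφ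
      (ih (ModuleCat.of R (X ⧸ LinearMap.range φ)) fun j =>
        vanishes_quotient_range hφ (hZ (j + 1)) (hXF.vanishes hF j))
      (hX X hXF (i + 1))

/-- A module `M` with `H^i_I(M) = 0` for `i ≥ 2` maps, with torsion kernel and cokernel, to a module
`Z` without local cohomology: the sections of `M` on the complement of `V(I)`. -/
theorem exists_forall_vanishes (hF : (F : Set R) ⊆ I)
    (hI : I ≤ (Ideal.span (F : Set R)).radical) (M : Type u) [AddCommGroup M] [Module R M]
    (hM : ∀ i, 2 ≤ i → Vanishes I i M) :
    ∃ (Z : ModuleCat.{u} R) (φ : M →ₗ[R] Z), (∀ i, Vanishes I i Z) ∧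
      LinearMap.ker φ ≤ torsionSubmodule I M ∧ IsTorsion I (Z ⧸ LinearMap.range φ) := by
  obtain ⟨X, φ, hXF, hφ⟩ := exists_cover hI M
  let T := torsionSubmodule I (X ⧸ LinearMap.range φ)
  let Z : Submodule R X := T.comap (LinearMap.range φ).mkQ
  have hX := hXF.vanishes hF
  have hQ (i : ℕ) : Vanishes I i ((X ⧸ LinearMap.range φ) ⧸ T) := by
    cases i with
    | zero => exact vanishes_zero_iff_torsionSubmodule.2 torsionSubmodule_quotient_eq_bot
    | succ i =>
      exact (vanishes_quotient_range hφ (hM (i + 2) (by lia)) (hX (i + 1))).right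
        ((isTorsion_torsionSubmodule _ _).vanishes_succ _) T.injective_subtype
        (LinearMap.exact_subtype_mkQ _) (Submodule.mkQ_surjective _)
  have hZ (i : ℕ) : Vanishes I i Z := by
    cases i with
    | zero => exact (hX 0).zero_of_injective Z.injective_subtype
    | succ i =>
      refine (hQ i).left (hX (i + 1)) (f := Z.subtype)
        (g := T.mkQ ∘ₗ (LinearMap.range φ).mkQ) Z.injective_subtype ?_
        ((Submodule.mkQ_surjective _).comp (Submodule.mkQ_surjective _))
      rw [LinearMap.exact_iff, LinearMap.ker_comp, Submodule.ker_mkQ, Submodule.range_subtype]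
  have hφZ (m : M) : φ m ∈ Z := by
    have : (LinearMap.range φ).mkQ (φ m) = 0 := by simp
    rw [Submodule.mem_comap, this]
    exact T.zero_mem
  refine ⟨ModuleCat.of R Z, φ.codRestrict Z hφZ, hZ, by simpa using hφ, fun x => ?_⟩
  obtain ⟨z, rfl⟩ := Submodule.Quotient.mk_surjective _ x
  intro a ha
  obtain ⟨n, hn⟩ := z.2 a ha
  refine ⟨n, ?_⟩
  rw [← map_smul, Submodule.mkQ_apply, Submodule.Quotient.mk_eq_zero] at hn
  obtain ⟨m, hm⟩ := hn
  rw [← Submodule.Quotient.mk_smul, Submodule.Quotient.mk_eq_zero]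
  exact ⟨m, Subtype.ext hm⟩

/-- If an exact functor takes modules without local cohomology to modules without local cohomology
in degrees above `d`, then it raises cohomological dimensions `c + 1` to at most `c + d`. -/
theorem IsExactTorsion.vanishes_of_lt (hG : IsExactTorsion G I 𝔞) (hF : (F : Set R) ⊆ I)
    (hI : I ≤ (Ideal.span (F : Set R)).radical) (hd : 1 ≤ d)
    (hZ : ∀ Z : ModuleCat.{u} R, (∀ i, Vanishes I i Z) → ∀ i, d < i → Vanishes 𝔞 i (G.obj Z))
    (c : ℕ) : ∀ M : ModuleCat.{u} R, (∀ i, c + 1 < i → Vanishes I i M) →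
      ∀ i, c + d < i → Vanishes 𝔞 i (G.obj M) := by
  induction c with
  | zero =>
    intro M hM i hi
    obtain ⟨Z, φ, hZ0, hφ, hT⟩ := exists_forall_vanishes hF hI M fun i hi => hM i (by lia)
    obtain ⟨i, rfl⟩ : ∃ j, i = j + 2 := ⟨i - 2, by lia⟩
    exact hG.vanishes_of_quotient_range hφ ((hG.isTorsion _ hT).vanishes_succ _)
      (hZ Z hZ0 _ (by lia))
  | succ c ih =>
    intro M hM i hi
    obtain ⟨X, φ, hXF, hφ⟩ := exists_cover hI M
    obtain ⟨i, rfl⟩ : ∃ j, i = j + 1 := ⟨i - 1, by lia⟩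
    exact hG.vanishes_of_quotient_range hφ
      (ih (ModuleCat.of R (X ⧸ LinearMap.range φ)) (fun j hj =>
        vanishes_quotient_range hφ (hM (j + 1) (by lia)) (hXF.vanishes hF j)) i (by lia))
      (hZ X (hXF.vanishes hF) _ (by lia))

end Transfer

/-! ### Tensor products over the ground field -/

section OuterTensor

/-- An `R`-module, regarded as a vector space over `k` for a `k`-algebra `R`. Unlike
`RestrictScalars`, it retains the structure of an `R`-module. -/
def Restricted (_k : Type w) {R : Type u} [CommRing R] (M : Type v) [AddCommGroup M] [Module R M] :
    Type v := M

namespace Restricted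

variable {k : Type w} {R : Type u} [Field k] [CommRing R] [Algebra k R] {M : Type v}
  [AddCommGroup M] [Module R M]

instance : AddCommGroup (Restricted k (R := R) M) := inferInstanceAs (AddCommGroup M)

instance : Module R (Restricted k (R := R) M) := inferInstanceAs (Module R M)

instance : Module k (Restricted k (R := R) M) := Module.compHom M (algebraMap k R)

instance : IsScalarTower k R (Restricted k (R := R) M) where
  smul_assoc c r m := by
    rw [Algebra.smul_def, mul_smul]
    rfl

end Restricted

/-- The tensor product over `k` of an `R`-module and an `S`-module. It is a type synonym, as it
carries the structure of an `R ⊗ S`-module. -/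
def OuterTensor (k : Type w) (R : Type u) (S : Type v) [Field k] [CommRing R] [CommRing S]
    [Algebra k R] [Algebra k S] (M : Type u) (N : Type v) [AddCommGroup M] [Module R M]
    [AddCommGroup N] [Module S N] : Type (max u v) :=
  Restricted k (R := R) M ⊗[k] Restricted k (R := S) N

namespace OuterTensor

variable {k : Type w} {R : Type u} {S : Type v} [Field k] [CommRing R] [CommRing S]
  [Algebra k R] [Algebra k S] {M M' : Type u} {N N' : Type v}
  [AddCommGroup M] [Module R M] [AddCommGroup M'] [Module R M']
  [AddCommGroup N] [Module S N] [AddCommGroup N'] [Module S N']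

noncomputable instance : AddCommGroup (OuterTensor k R S M N) :=
  inferInstanceAs (AddCommGroup (Restricted k (R := R) M ⊗[k] Restricted k (R := S) N))

variable (k R S M N) in
/-- The action of `R ⊗ S` on the tensor product of an `R`-module and an `S`-module. -/
noncomputable def action :
    R ⊗[k] S →ₐ[k] Module.End k (Restricted k (R := R) M ⊗[k] Restricted k (R := S) N) :=
  (Module.endTensorEndAlgHom (S := k)).comp
    (Algebra.TensorProduct.map (Algebra.lsmul k k (Restricted k (R := R) M))
      (Algebra.lsmul k k (Restricted k (R := S) N)))

noncomputable instance : Module (R ⊗[k] S) (OuterTensor k R S M N) :=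
  Module.compHom (Restricted k (R := R) M ⊗[k] Restricted k (R := S) N) (action k R S M N).toRingHom

variable (k R S) in
/-- The pure tensor `m ⊗ n`. -/
noncomputable def tmul (m : M) (n : N) : OuterTensor k R S M N :=
  TensorProduct.tmul k (M := Restricted k (R := R) M) (N := Restricted k (R := S) N) m n

theorem smul_tmul (r : R) (s : S) (m : M) (n : N) :
    (r ⊗ₜ[k] s) • tmul k R S m n = tmul k R S (r • m) (s • n) := rfl

@[elab_as_elim]
theorem induction {p : OuterTensor k R S M N → Prop} (x : OuterTensor k R S M N) (zero : p 0)
    (tmul : ∀ m n, p (tmul k R S m n)) (add : ∀ x y, p x → p y → p (x + y)) : p x :=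
  TensorProduct.induction_on (motive := p) x zero tmul add

/-- The underlying `k`-linear map of an `R`-linear map. -/
def restrictMap (f : M →ₗ[R] M') : Restricted k (R := R) M →ₗ[k] Restricted k (R := R) M' where
  toFun := f
  map_add' := f.map_add
  map_smul' c m := f.map_smul (algebraMap k R c) m

variable (k S) in
/-- The additive map underlying `f ⊗ g`. -/
noncomputable def mapAddHom (f : M →ₗ[R] M') (g : N →ₗ[S] N') :
    OuterTensor k R S M N →+ OuterTensor k R S M' N' :=
  (TensorProduct.map (restrictMap (k := k) f) (restrictMap (k := k) g)).toAddMonoidHom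

variable (k S) in
/-- The map `f ⊗ g` induced by linear maps `f` and `g`. -/
noncomputable def map (f : M →ₗ[R] M') (g : N →ₗ[S] N') :
    OuterTensor k R S M N →ₗ[R ⊗[k] S] OuterTensor k R S M' N' where
  __ := mapAddHom k S f g
  map_smul' := by
    intro t x
    change mapAddHom k S f g (t • x) = t • mapAddHom k S f g x
    induction t using TensorProduct.induction_on with
    | zero => rw [zero_smul, map_zero, zero_smul]
    | add t t' h h' => rw [add_smul, map_add, h, h', ← add_smul]
    | tmul r s =>
      induction x using OuterTensor.induction with
      | zero => rw [smul_zero, map_zero, smul_zero]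
      | add x y h h' => rw [smul_add, map_add, h, h', map_add, smul_add]
      | tmul m n =>
        change tmul k R S (f (r • m)) (g (s • n)) = tmul k R S (r • f m) (s • g n)
        rw [map_smul, map_smul]

theorem map_tmul (f : M →ₗ[R] M') (g : N →ₗ[S] N') (m : M) (n : N) :
    map k S f g (tmul k R S m n) = tmul k R S (f m) (g n) := rfl

theorem hom_ext {P : Type*} [AddCommGroup P] [Module (R ⊗[k] S) P]
    {f g : OuterTensor k R S M N →ₗ[R ⊗[k] S] P}
    (h : ∀ m n, f (tmul k R S m n) = g (tmul k R S m n)) : f = g := by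
  ext x
  induction x using OuterTensor.induction with
  | zero => simp
  | tmul m n => exact h m n
  | add x y hx hy => rw [map_add, hx, hy, map_add]

variable (k R S)

/-- The functor `M ↦ M ⊗ N`. -/
noncomputable def leftFunctor (N : ModuleCat.{v} S) :
    ModuleCat.{u} R ⥤ ModuleCat.{max u v} (R ⊗[k] S) where
  obj M := ModuleCat.of _ (OuterTensor k R S M N)
  map f := ModuleCat.ofHom (map k S f.hom LinearMap.id)
  map_id M := by
    ext x
    exact congrArg (fun φ => φ x) (hom_ext (f := map k S LinearMap.id LinearMap.id)
      (g := LinearMap.id) fun m n => rfl)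
  map_comp f g := by
    ext x
    exact congrArg (fun φ => φ x) (hom_ext (f := map k S (g.hom ∘ₗ f.hom) LinearMap.id)
      (g := map k S g.hom LinearMap.id ∘ₗ map k S f.hom LinearMap.id) fun m n => rfl)

/-- The functor `N ↦ M ⊗ N`. -/
noncomputable def rightFunctor (M : ModuleCat.{u} R) :
    ModuleCat.{v} S ⥤ ModuleCat.{max u v} (R ⊗[k] S) where
  obj N := ModuleCat.of _ (OuterTensor k R S M N)
  map f := ModuleCat.ofHom (map k S LinearMap.id f.hom)
  map_id N := by
    ext x
    exact congrArg (fun φ => φ x) (hom_ext (f := map k S LinearMap.id LinearMap.id)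
      (g := LinearMap.id) fun m n => rfl)
  map_comp f g := by
    ext x
    exact congrArg (fun φ => φ x) (hom_ext (f := map k S LinearMap.id (g.hom ∘ₗ f.hom))
      (g := map k S LinearMap.id g.hom ∘ₗ map k S LinearMap.id f.hom) fun m n => rfl)

variable {k R S} {A : Type (max u v)} [CommRing A] {ρ : A →+* R ⊗[k] S} {I : Ideal R}
  {J : Ideal S} {𝔞 : Ideal A}

/-- If each pure tensor is killed by powers of the elements of `𝔟`, so is each tensor. -/
theorem isTorsion_of_forall_tmul {𝔟 : Ideal (R ⊗[k] S)}
    (h : ∀ m n, 𝔟 ≤ Ideal.radical (LinearMap.ker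
      (LinearMap.toSpanSingleton (R ⊗[k] S) (OuterTensor k R S M N) (tmul k R S m n)))) :
    IsTorsion 𝔟 (OuterTensor k R S M N) := by
  intro x
  induction x using OuterTensor.induction with
  | zero => exact Submodule.zero_mem _
  | tmul m n => exact fun a ha => (h m n ha).imp fun l hl => by simpa using hl
  | add x y hx hy => exact Submodule.add_mem _ hx hy

theorem isTorsion_left (hM : IsTorsion I M) :
    IsTorsion (I.map (Algebra.TensorProduct.includeLeft : R →ₐ[k] R ⊗[k] S))
      (OuterTensor k R S M N) := by
  refine isTorsion_of_forall_tmul fun m n => Ideal.map_le_iff_le_comap.2 fun a ha => ?_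
  obtain ⟨l, hl⟩ := hM m a ha
  refine ⟨l, ?_⟩
  rw [LinearMap.mem_ker, LinearMap.toSpanSingleton_apply, ← map_pow]
  change (a ^ l) ⊗ₜ[k] (1 : S) • tmul k R S m n = 0
  rw [smul_tmul, hl]
  exact TensorProduct.zero_tmul _ _

theorem isTorsion_right (hN : IsTorsion J N) :
    IsTorsion (J.map (Algebra.TensorProduct.includeRight : S →ₐ[k] R ⊗[k] S))
      (OuterTensor k R S M N) := by
  refine isTorsion_of_forall_tmul fun m n => Ideal.map_le_iff_le_comap.2 fun a ha => ?_
  obtain ⟨l, hl⟩ := hN n a ha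
  refine ⟨l, ?_⟩
  rw [LinearMap.mem_ker, LinearMap.toSpanSingleton_apply, ← map_pow]
  change (1 : R) ⊗ₜ[k] (a ^ l) • tmul k R S m n = 0
  rw [smul_tmul, hl]
  exact TensorProduct.tmul_zero _ _

theorem isExactTorsion_leftFunctor (N : ModuleCat.{v} S)
    (h : 𝔞.map ρ ≤ I.map (Algebra.TensorProduct.includeLeft : R →ₐ[k] R ⊗[k] S)) :
    IsExactTorsion (leftFunctor k R S N ⋙ ModuleCat.restrictScalars ρ) I 𝔞 where
  injective f hf := Module.Flat.rTensor_preserves_injective_linearMap (restrictMap f.hom) hf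
  exact f g hfg hg := rTensor_exact (Restricted k (R := S) N) (f := restrictMap f.hom)
    (g := restrictMap g.hom) hfg hg
  surjective f hf := LinearMap.rTensor_surjective (Restricted k (R := S) N)
    (g := restrictMap f.hom) hf
  isTorsion M hM x a ha := isTorsion_left (k := k) (N := N) hM x (ρ a)
    (h (Ideal.mem_map_of_mem ρ ha)) |>.imp
    fun n hn => by
      rw [← map_pow] at hn
      exact hn

theorem isExactTorsion_rightFunctor (M : ModuleCat.{u} R)
    (h : 𝔞.map ρ ≤ J.map (Algebra.TensorProduct.includeRight : S →ₐ[k] R ⊗[k] S)) :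
    IsExactTorsion (rightFunctor k R S M ⋙ ModuleCat.restrictScalars ρ) J 𝔞 where
  injective f hf := Module.Flat.lTensor_preserves_injective_linearMap (restrictMap f.hom) hf
  exact f g hfg hg := lTensor_exact (Restricted k (R := R) M) (f := restrictMap f.hom)
    (g := restrictMap g.hom) hfg hg
  surjective f hf := LinearMap.lTensor_surjective (Restricted k (R := R) M)
    (g := restrictMap f.hom) hf
  isTorsion N hN x a ha := isTorsion_right (k := k) (M := M) hN x (ρ a)
    (h (Ideal.mem_map_of_mem ρ ha)) |>.imp
    fun n hn => by
      rw [← map_pow] at hn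
      exact hn

/-- `M ⊗ N` as a module over `A`, by restriction of scalars along `ρ : A ⟶ R ⊗ S`. -/
noncomputable abbrev restrict (ρ : A →+* R ⊗[k] S) (M : Type u) (N : Type v)
    [AddCommGroup M] [Module R M] [AddCommGroup N] [Module S N] : ModuleCat.{max u v} A :=
  (ModuleCat.restrictScalars ρ).obj (ModuleCat.of _ (OuterTensor k R S M N))

theorem sum_smul_map_eq_id {F : Finset R} {F' : Finset S} {ψ : F → Module.End R M}
    {ψ' : F' → Module.End S N} (hψ : ∑ f : F, (f : R) • ψ f = 1)
    (hψ' : ∑ f : F', (f : S) • ψ' f = 1) :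
    ∑ f : F, ∑ f' : F', ((f : R) ⊗ₜ[k] (f' : S)) • map k S (ψ f) (ψ' f') = LinearMap.id := by
  refine hom_ext fun m n => ?_
  have hm : ∑ f : F, (f : R) • ψ f m = m := by simpa using congrArg (fun φ => φ m) hψ
  have hn : ∑ f : F', (f : S) • ψ' f n = n := by simpa using congrArg (fun φ => φ n) hψ'
  simp only [LinearMap.sum_apply, LinearMap.smul_apply, map_tmul, smul_tmul, LinearMap.id_apply]
  have h1 (m : M) (v : F' → N) : ∑ f', tmul k R S m (v f') = tmul k R S m (∑ f', v f') :=
    (TensorProduct.tmul_sum (M := Restricted k (R := R) M) (N := Restricted k (R := S) N)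
      m Finset.univ v).symm
  have h2 (u : F → M) (n : N) : ∑ f, tmul k R S (u f) n = tmul k R S (∑ f, u f) n :=
    (TensorProduct.sum_tmul (M := Restricted k (R := R) M) (N := Restricted k (R := S) N)
      Finset.univ u n).symm
  simp only [h1, hn, h2, hm]

/-- If the identities of `M` and `N` are combinations of endomorphisms with coefficients in `F` and
`F'`, then the identity of `M ⊗ N` is a combination with coefficients the products `f ⊗ f'`. -/
theorem vanishes_of_isCovered {F : Finset R} {F' : Finset S}
    (hFF' : ∀ f ∈ F, ∀ f' ∈ F', ∃ a ∈ 𝔞, ρ a = f ⊗ₜ[k] f') (hM : IsCovered F M)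
    (hN : IsCovered F' N) (i : ℕ) : Vanishes 𝔞 i (restrict ρ M N) := by
  obtain ⟨ψ, hψ⟩ := hM
  obtain ⟨ψ', hψ'⟩ := hN
  choose! a ha hρ using hFF'
  refine vanishes_of_one_mem ?_ i
  let χ (f : F) (f' : F') : Module.End A (restrict ρ M N) :=
    ((ModuleCat.restrictScalars ρ).map (ModuleCat.ofHom (map k S (ψ f) (ψ' f')))).hom
  have h1 : ∑ f : F, ∑ f' : F', a f f' • χ f f' = 1 := by
    refine LinearMap.ext fun x => ?_
    have h2 (x : OuterTensor k R S M N) :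
        ∑ f : F, ∑ f' : F', ((f : R) ⊗ₜ[k] (f' : S)) • map k S (ψ f) (ψ' f') x = x := by
      simpa using congrArg (fun φ => φ x) (sum_smul_map_eq_id (k := k) hψ hψ')
    simp only [LinearMap.sum_apply, LinearMap.smul_apply]
    refine Eq.trans (Finset.sum_congr rfl fun f _ => Finset.sum_congr rfl fun f' _ => ?_) (h2 x)
    rw [← hρ f f.2 f' f'.2]
    rfl
  rw [← h1]
  exact Submodule.sum_mem _ fun f _ => Submodule.sum_mem _ fun f' _ =>
    Submodule.smul_mem_smul (ha f f.2 f' f'.2) trivial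

/-- A Künneth-type bound: cohomological dimensions `c + 1` and `d + 1` of `M` and `N` give the bound
`c + d + 1` for `M ⊗ N`, if `𝔞` defines the same closed set as the product of the ideals `I` and `J`
in `R ⊗ S`. -/
theorem vanishes_of_lt [IsNoetherianRing R] [IsNoetherianRing S] [IsNoetherianRing A]
    {F : Finset R} {F' : Finset S} (hF : (F : Set R) ⊆ I)
    (hI : I ≤ (Ideal.span (F : Set R)).radical) (hF' : (F' : Set S) ⊆ J)
    (hJ : J ≤ (Ideal.span (F' : Set S)).radical)
    (hFF' : ∀ f ∈ F, ∀ f' ∈ F', ∃ a ∈ 𝔞, ρ a = f ⊗ₜ[k] f')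
    (hleft : 𝔞.map ρ ≤ I.map (Algebra.TensorProduct.includeLeft : R →ₐ[k] R ⊗[k] S))
    (hright : 𝔞.map ρ ≤ J.map (Algebra.TensorProduct.includeRight : S →ₐ[k] R ⊗[k] S))
    {c d : ℕ} (hM : ∀ i, c + 1 < i → Vanishes I i M) (hN : ∀ i, d + 1 < i → Vanishes J i N)
    (i : ℕ) (hi : c + d + 1 < i) : Vanishes 𝔞 i (restrict ρ M N) := by
  have hl (N : ModuleCat.{v} S) := isExactTorsion_leftFunctor N hleft
  have hr (M : ModuleCat.{u} R) := isExactTorsion_rightFunctor M hright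
  -- first for both `M` and `N` without local cohomology
  have h1 (M : ModuleCat.{u} R) (N : ModuleCat.{v} S) (hM : ∀ i, Vanishes I i M)
      (hN : ∀ i, Vanishes J i N) (i : ℕ) : Vanishes 𝔞 i (restrict ρ M N) :=
    (hl N).vanishes_of_forall_vanishes hF hI (fun X hX i =>
      (hr X).vanishes_of_forall_vanishes hF' hJ
        (fun Y hY i => vanishes_of_isCovered hFF' hX hY i) i N hN) i M hM
  -- then for `M` without local cohomology and arbitrary `N`
  have h2 (M : ModuleCat.{u} R) (hM : ∀ i, Vanishes I i M) (i : ℕ) (hi : d + 1 < i) :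
      Vanishes 𝔞 i (restrict ρ M N) :=
    (hr M).vanishes_of_lt hF' hJ le_rfl (fun Z hZ i _ => h1 M Z hM hZ i) d (ModuleCat.of S N)
      hN i hi
  exact (hl (ModuleCat.of S N)).vanishes_of_lt hF hI (d := d + 1) (by lia)
    (fun Z hZ i hi => h2 Z hZ i hi) c (ModuleCat.of R M) hM i (by lia)

end OuterTensor
end OuterTensor

/-! ### Modules without local cohomology, and cohomological dimension -/

section Depth

variable {R : Type u} [CommRing R] [IsNoetherianRing R] {I : Ideal R}

/-- A finitely generated module without `I`-torsion has a regular element in `I`: otherwise `I` lies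
in an associated prime, and there is a nonzero map from `R / I` to the module. -/
theorem exists_isSMulRegular_of_torsionSubmodule_eq_bot {Z : Type v} [AddCommGroup Z] [Module R Z]
    [Module.Finite R Z] (h : torsionSubmodule I Z = ⊥) : ∃ a ∈ I, IsSMulRegular Z a := by
  have hs : Subsingleton ((R ⧸ I) →ₗ[R] Z) := by
    refine ⟨fun f g => ?_⟩
    have h0 (f : (R ⧸ I) →ₗ[R] Z) : f = 0 := by
      refine Submodule.linearMap_qext _ (LinearMap.ext_ring ?_)
      have : f (Submodule.Quotient.mk 1) ∈ torsionSubmodule I Z := fun a ha => ⟨1, by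
        rw [pow_one, ← map_smul, ← Submodule.Quotient.mk_smul,
          (Submodule.Quotient.mk_eq_zero _).2 (by simpa using ha), map_zero]⟩
      rw [h] at this
      exact this
    rw [h0 f, h0 g]
  obtain ⟨a, ha, hreg⟩ := IsSMulRegular.subsingleton_linearMap_iff.1 hs
  exact ⟨a, by rwa [Ideal.annihilator_quotient] at ha, hreg⟩

/-- A finitely generated module `Z` without local cohomology satisfies `Z = I Z`: as long as a
quotient of this kind is not zero, dividing by an element of `I` regular on it gives a smaller
one. -/
theorem smul_top_eq_top_of_forall_vanishes {Z : Type u} [AddCommGroup Z] [Module R Z]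
    [Module.Finite R Z] (h : ∀ i, Vanishes I i Z) : I • (⊤ : Submodule R Z) = ⊤ := by
  let P : Set (Submodule R Z) := {B | B ≤ I • ⊤ ∧ ∀ i, Vanishes I i (Z ⧸ B)}
  have hP : P.Nonempty :=
    ⟨⊥, bot_le, fun i => (h i).congr (Submodule.quotEquivOfEqBot ⊥ rfl).symm⟩
  obtain ⟨B, ⟨hBI, hB⟩, hmax⟩ :=
    set_has_maximal_iff_noetherian.2 (inferInstanceAs (IsNoetherian R Z)) P hP
  obtain ⟨a, ha, hreg⟩ := exists_isSMulRegular_of_torsionSubmodule_eq_bot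
    (vanishes_zero_iff_torsionSubmodule.1 (hB 0))
  let B' : Submodule R Z := (LinearMap.range (LinearMap.lsmul R (Z ⧸ B) a)).comap B.mkQ
  have hmem (z : Z) : z ∈ B' ↔ ∃ y : Z ⧸ B, a • y = Submodule.Quotient.mk z := by
    simp [B']
  have hle : B ≤ B' := fun z hz => (hmem z).2 ⟨0, by
    rw [smul_zero, eq_comm, Submodule.Quotient.mk_eq_zero]; exact hz⟩
  have hB' : B' ∈ P := by
    constructor
    · intro z hz
      obtain ⟨y, hy⟩ := (hmem z).1 hz
      obtain ⟨y, rfl⟩ := Submodule.Quotient.mk_surjective _ y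
      rw [← Submodule.Quotient.mk_smul, Submodule.Quotient.eq] at hy
      rw [← sub_sub_cancel (a • y) z]
      exact Submodule.sub_mem _ (Submodule.smul_mem_smul ha trivial) (hBI hy)
    · intro i
      refine (hB i).right (hB (i + 1)) (f := LinearMap.lsmul R (Z ⧸ B) a)
        (g := Submodule.mapQ B B' LinearMap.id hle) hreg ?_ ?_
      · intro y
        obtain ⟨z, rfl⟩ := Submodule.Quotient.mk_surjective _ y
        rw [Submodule.mapQ_apply, LinearMap.id_apply, Submodule.Quotient.mk_eq_zero, hmem]
        rfl
      · intro y
        obtain ⟨z, rfl⟩ := Submodule.Quotient.mk_surjective _ y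
        exact ⟨Submodule.Quotient.mk z, rfl⟩
  have hBB' : B' ≤ B := not_lt_iff_le_imp_ge.1 (hmax B' hB') hle
  rw [eq_top_iff]
  intro z _
  refine hBI ?_
  have : a • (Submodule.Quotient.mk z : Z ⧸ B) = 0 := by
    rw [← Submodule.Quotient.mk_smul, Submodule.Quotient.mk_eq_zero]
    exact hBB' ((hmem _).2 ⟨Submodule.Quotient.mk z, rfl⟩)
  exact (Submodule.Quotient.mk_eq_zero _).1 (hreg (this.trans (smul_zero a).symm))

end Depth

section CohomologicalDimension

variable {A : Type u} [CommRing A] {𝔞 : Ideal A}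

theorem vanishes_of_cohomologicalDimension_le {n i : ℕ}
    (h : cohomologicalDimension 𝔞 ≤ ((n : ℕ∞) : WithBot ℕ∞)) (hi : n < i) : Vanishes 𝔞 i A := by
  by_contra hv
  have h1 := (le_iSup₂_of_le (f := fun (i : ℕ) (_ : ¬ IsZero
    ((localCohomology 𝔞 i).obj (ModuleCat.of A A))) => ((i : ℕ∞) : WithBot ℕ∞)) i hv le_rfl).trans h
  have : i ≤ n := by exact_mod_cast h1
  lia

theorem cohomologicalDimension_le {n : ℕ} (h : ∀ i, n < i → Vanishes 𝔞 i A) :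
    cohomologicalDimension 𝔞 ≤ ((n : ℕ∞) : WithBot ℕ∞) := by
  refine iSup₂_le fun i hi => ?_
  by_contra hn
  refine hi (h i ?_)
  rw [not_le] at hn
  exact_mod_cast hn

theorem zero_le_cohomologicalDimension [IsNoetherianRing A] (h𝔞 : 𝔞 ≠ ⊤) :
    0 ≤ cohomologicalDimension 𝔞 := by
  by_contra h
  refine h𝔞 ?_
  have hv (i : ℕ) : Vanishes 𝔞 i A := by
    by_contra hv
    refine h (le_trans ?_ (le_iSup₂_of_le (f := fun (i : ℕ) (_ : ¬ IsZero
      ((localCohomology 𝔞 i).obj (ModuleCat.of A A))) => ((i : ℕ∞) : WithBot ℕ∞)) i hv le_rfl))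
    exact_mod_cast Nat.zero_le i
  simpa using! smul_top_eq_top_of_forall_vanishes hv

/-- If the higher local cohomology of the ring vanishes, then the ring is the sum of `𝔞` and the
`𝔞`-torsion ideal. -/
theorem exists_one_sub_mem_torsionSubmodule [IsNoetherianRing A]
    (h : cohomologicalDimension 𝔞 = 0) : ∃ a ∈ 𝔞, 1 - a ∈ torsionSubmodule 𝔞 A := by
  have hv (i : ℕ) : Vanishes 𝔞 i (A ⧸ torsionSubmodule 𝔞 A) := by
    cases i with
    | zero => exact vanishes_zero_iff_torsionSubmodule.2 torsionSubmodule_quotient_eq_bot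
    | succ i =>
      exact (vanishes_of_cohomologicalDimension_le (n := 0) h.le (by lia)).right
        ((isTorsion_torsionSubmodule 𝔞 A).vanishes_succ _)
        (torsionSubmodule 𝔞 A).injective_subtype
        (LinearMap.exact_subtype_mkQ _) (Submodule.mkQ_surjective _)
  have h1 := smul_top_eq_top_of_forall_vanishes hv
  have h2 : (torsionSubmodule 𝔞 A).mkQ 1 ∈
      (𝔞 • (⊤ : Submodule A A)).map (torsionSubmodule 𝔞 A).mkQ := by
    rw [Submodule.map_smul'', Submodule.map_top, Submodule.range_mkQ, h1]
    trivial
  obtain ⟨a, ha, hx⟩ := h2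
  refine ⟨a, by simpa using! ha, ?_⟩
  rw [eq_comm, Submodule.mkQ_apply, Submodule.mkQ_apply, Submodule.Quotient.eq] at hx
  exact hx

end CohomologicalDimension

/-! ### Homogeneous ideals of standard graded algebras -/

section StandardGraded

variable {k : Type w} {R : Type u} [Field k] [CommRing R] [Algebra k R] {𝒜 : ℕ → Submodule k R}
  [GradedAlgebra 𝒜] {I : Ideal R}

theorem isNoetherianRing_of_isStandardGraded (h : IsStandardGraded 𝒜) : IsNoetherianRing R := by
  obtain ⟨n, φ, hφ, -⟩ := h
  exact isNoetherianRing_of_surjective _ _ φ.toRingHom hφ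

theorem finiteType_of_isStandardGraded (h : IsStandardGraded 𝒜) : Algebra.FiniteType k R := by
  obtain ⟨n, φ, hφ, -⟩ := h
  exact Algebra.FiniteType.of_surjective φ hφ

/-- The degree zero part of a standard graded algebra consists of the constants. -/
theorem exists_algebraMap_eq_of_mem_zero (h : IsStandardGraded 𝒜) {r : R} (hr : r ∈ 𝒜 0) :
    ∃ c : k, algebraMap k R c = r := by
  obtain ⟨n, φ, hφ, hd⟩ := h
  obtain ⟨p, rfl⟩ := hφ r
  refine ⟨MvPolynomial.coeff 0 p, ?_⟩
  have hsum : φ p = ∑ i ∈ Finset.range (p.totalDegree + 1),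
      φ (MvPolynomial.homogeneousComponent i p) := by
    rw [← map_sum, MvPolynomial.sum_homogeneousComponent]
  have hmem (i : ℕ) : φ (MvPolynomial.homogeneousComponent i p) ∈ 𝒜 i :=
    hd i _ (MvPolynomial.homogeneousComponent_isHomogeneous i p)
  rw [← DirectSum.decompose_of_mem_same 𝒜 hr, hsum, DirectSum.decompose_sum,
    DFinsupp.finsetSum_apply, AddSubmonoidClass.coe_finsetSum,
    Finset.sum_eq_single_of_mem 0 (by simp)]
  · rw [DirectSum.decompose_of_mem_same 𝒜 (hmem 0), MvPolynomial.homogeneousComponent_zero,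
      MvPolynomial.algHom_C]
  · exact fun i _ hi => DirectSum.decompose_of_mem_ne 𝒜 (hmem i) hi

theorem eq_zero_of_mem_of_mem_zero (h : IsStandardGraded 𝒜) (hI' : I ≠ ⊤) {a : R} (ha : a ∈ I)
    (ha0 : a ∈ 𝒜 0) : a = 0 := by
  obtain ⟨c, rfl⟩ := exists_algebraMap_eq_of_mem_zero h ha0
  by_contra hc
  refine hI' (Ideal.eq_top_of_isUnit_mem _ ha ((IsUnit.mk0 c ?_).map (algebraMap k R)))
  rintro rfl
  simp at hc

/-- In a graded ring, `1 - b` is a nonzerodivisor if the degree zero component of `b` vanishes. -/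
theorem eq_zero_of_mul_eq_self {b y : R} (hb : (DirectSum.decompose 𝒜 b 0 : R) = 0)
    (hy : y * b = y) : y = 0 := by
  classical
  have key (n : ℕ) : (DirectSum.decompose 𝒜 y n : R) = 0 := by
    induction n using Nat.strong_induction_on with
    | _ n ih =>
      rw [← hy, DirectSum.decompose_mul, DirectSum.coe_mul_apply_eq_sum_antidiagonal]
      refine Finset.sum_eq_zero fun p hp => ?_
      replace hp : p.1 + p.2 = n := Finset.HasAntidiagonal.mem_antidiagonal.1 hp
      rcases Nat.eq_zero_or_pos p.2 with h0 | h0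
      · rw [h0, hb, mul_zero]
      · rw [ih p.1 (by lia), zero_mul]
  rw [← DirectSum.sum_support_decompose 𝒜 y]
  exact Finset.sum_eq_zero fun n _ => key n

/-- A proper homogeneous ideal `I` of cohomological dimension zero is nil: the ring is the sum of
`I` and the `I`-torsion, so that `1 - b` is torsion for some `b ∈ I`, and `1 - b` is a nonzerodivisor
by homogeneity. -/
theorem exists_pow_eq_zero_of_cohomologicalDimension_eq_zero (h : IsStandardGraded 𝒜)
    (hI : I.IsHomogeneous 𝒜) (hI' : I ≠ ⊤) (h0 : cohomologicalDimension I = 0) {a : R}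
    (ha : a ∈ I) : ∃ n : ℕ, a ^ n = 0 := by
  have := isNoetherianRing_of_isStandardGraded h
  obtain ⟨b, hb, hb'⟩ := exists_one_sub_mem_torsionSubmodule h0
  obtain ⟨n, hn⟩ := hb' a ha
  refine ⟨n, eq_zero_of_mul_eq_self (𝒜 := 𝒜) (b := b) ?_ ?_⟩
  · exact eq_zero_of_mem_of_mem_zero h hI' (hI 0 hb) (SetLike.coe_mem _)
  · rw [smul_eq_mul, mul_sub, mul_one, sub_eq_zero] at hn
    exact hn.symm

/-- A proper homogeneous ideal is, up to radical, generated by elements of any given degree that is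
sufficiently divisible. -/
theorem exists_finset_subset_degree (h : IsStandardGraded 𝒜) (hI : I.IsHomogeneous 𝒜)
    (hI' : I ≠ ⊤) : ∃ D₀ : ℕ, 0 < D₀ ∧ ∀ D, 0 < D → D₀ ∣ D → ∃ F : Finset R, (F : Set R) ⊆ I ∧
      (∀ f ∈ F, f ∈ 𝒜 D) ∧ I ≤ (Ideal.span (F : Set R)).radical := by
  classical
  have := isNoetherianRing_of_isStandardGraded h
  obtain ⟨s, hs⟩ := (Ideal.IsHomogeneous.iff_exists 𝒜 I).1 hI
  obtain ⟨t, hts, ht⟩ := (Submodule.fg_span_iff_fg_span_finset_subset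
    (R := R) ((↑) '' s : Set R)).1 (IsNoetherian.noetherian _)
  have htI : I = Ideal.span (t : Set R) := hs.trans ht
  have hd (x : R) (hx : x ∈ t) : ∃ d, 0 < d ∧ x ∈ 𝒜 d := by
    obtain ⟨⟨_, d, hd⟩, -, rfl⟩ := hts hx
    rcases Nat.eq_zero_or_pos d with rfl | h0
    · have hxI : _ ∈ I := htI ▸ Ideal.subset_span hx
      exact ⟨1, one_pos, by
        rw [eq_zero_of_mem_of_mem_zero h hI' hxI hd]
        exact (𝒜 1).zero_mem⟩
    · exact ⟨d, h0, hd⟩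
  choose! d hd0 hd using hd
  refine ⟨∏ x ∈ t, d x, Finset.prod_pos hd0, fun D hD hdvd =>
    ⟨t.image fun x => x ^ (D / d x), ?_, ?_, ?_⟩⟩
  all_goals
    have hdx (x : R) (hx : x ∈ t) : d x ∣ D := (Finset.dvd_prod_of_mem d hx).trans hdvd
    have hpos (x : R) (hx : x ∈ t) : 0 < D / d x :=
      Nat.div_pos (Nat.le_of_dvd hD (hdx x hx)) (hd0 x hx)
  · intro f hf
    obtain ⟨x, hx, rfl⟩ := Finset.mem_image.1 hf
    exact I.pow_mem_of_mem (htI ▸ Ideal.subset_span hx) _ (hpos x hx)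
  · intro f hf
    obtain ⟨x, hx, rfl⟩ := Finset.mem_image.1 hf
    have := SetLike.pow_mem_graded (D / d x) (hd x hx)
    rwa [smul_eq_mul, Nat.div_mul_cancel (hdx x hx)] at this
  · rw [htI]
    exact Ideal.span_le.2 fun x hx => ⟨D / d x, Ideal.subset_span (Finset.mem_image_of_mem _ hx)⟩

end StandardGraded

/-! ### The Segre product as a direct summand -/

section Retraction

variable {k : Type w} {R : Type u} {S : Type v} [Field k] [CommRing R] [CommRing S]
  [Algebra k R] [Algebra k S] (𝒜 : ℕ → Submodule k R) (ℬ : ℕ → Submodule k S)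
  [GradedAlgebra 𝒜] [GradedAlgebra ℬ]

/-- The projection `r ⊗ s ↦ ∑ n, r_n ⊗ s_n` of `R ⊗ S` onto the Segre product. -/
noncomputable def diagonalProjection : R ⊗[k] S →ₗ[k] R ⊗[k] S :=
  TensorProduct.lift ((DirectSum.toModule k ℕ (S →ₗ[k] R ⊗[k] S) fun n =>
    ((TensorProduct.mk k R S).compl₂ (GradedAlgebra.proj ℬ n)).comp (𝒜 n).subtype).comp
      (DirectSum.decomposeLinearEquiv 𝒜).toLinearMap)

variable {𝒜 ℬ}

theorem diagonalProjection_tmul {n : ℕ} {r : R} (hr : r ∈ 𝒜 n) (s : S) :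
    diagonalProjection 𝒜 ℬ (r ⊗ₜ s) = r ⊗ₜ (DirectSum.decompose ℬ s n : S) := by
  lift r to 𝒜 n using hr
  simp [diagonalProjection, DirectSum.toModule_lof, GradedAlgebra.proj_apply]

theorem segreSubmodule_le {M : ℕ → Submodule k R} {N : ℕ → Submodule k S}
    {P : Submodule k (R ⊗[k] S)} (h : ∀ n, ∀ r ∈ M n, ∀ s ∈ N n, r ⊗ₜ s ∈ P) :
    segreSubmodule M N ≤ P :=
  iSup_le fun n => Submodule.map₂_le.2 (h n)

theorem tmul_mem_segreSubmodule {M : ℕ → Submodule k R} {N : ℕ → Submodule k S} {n : ℕ} {r : R}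
    {s : S} (hr : r ∈ M n) (hs : s ∈ N n) : r ⊗ₜ[k] s ∈ segreSubmodule M N :=
  le_iSup (fun n => Submodule.map₂ (TensorProduct.mk k R S) (M n) (N n)) n
    (Submodule.apply_mem_map₂ _ hr hs)

/-- To prove an additive property of tensors it suffices to consider `r ⊗ s` with `r`
homogeneous. -/
theorem homogeneous_induction {p : R ⊗[k] S → Prop} (zero : p 0)
    (tmul : ∀ n, ∀ r ∈ 𝒜 n, ∀ s : S, p (r ⊗ₜ s)) (add : ∀ x y, p x → p y → p (x + y))
    (x : R ⊗[k] S) : p x := by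
  induction x using TensorProduct.induction_on with
  | zero => exact zero
  | add x y hx hy => exact add x y hx hy
  | tmul r s =>
    induction r using DirectSum.Decomposition.inductionOn 𝒜 with
    | zero => rwa [TensorProduct.zero_tmul]
    | homogeneous r => exact tmul _ r r.2 s
    | add r r' h h' =>
      rw [TensorProduct.add_tmul]
      exact add _ _ h h'

theorem diagonalProjection_mem (x : R ⊗[k] S) :
    diagonalProjection 𝒜 ℬ x ∈ segreSubmodule 𝒜 ℬ := by
  induction x using homogeneous_induction (𝒜 := 𝒜) with
  | zero => rw [map_zero]; exact Submodule.zero_mem _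
  | add x y hx hy => rw [map_add]; exact Submodule.add_mem _ hx hy
  | tmul n r hr s =>
    rw [diagonalProjection_tmul hr]
    exact tmul_mem_segreSubmodule hr (SetLike.coe_mem _)

theorem diagonalProjection_of_mem {x : R ⊗[k] S} (hx : x ∈ segreSubmodule 𝒜 ℬ) :
    diagonalProjection 𝒜 ℬ x = x := by
  refine segreSubmodule_le (P := LinearMap.eqLocus (diagonalProjection 𝒜 ℬ) LinearMap.id)
    (fun n r hr s hs => ?_) hx
  rw [LinearMap.mem_eqLocus, diagonalProjection_tmul hr, DirectSum.decompose_of_mem_same ℬ hs,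
    LinearMap.id_apply]

theorem diagonalProjection_mul {a : R ⊗[k] S} (ha : a ∈ segreSubmodule 𝒜 ℬ) (x : R ⊗[k] S) :
    diagonalProjection 𝒜 ℬ (a * x) = a * diagonalProjection 𝒜 ℬ x := by
  refine segreSubmodule_le (P := LinearMap.eqLocus
    (diagonalProjection 𝒜 ℬ ∘ₗ LinearMap.mulRight k x)
    (LinearMap.mulRight k (diagonalProjection 𝒜 ℬ x))) (fun n r hr s hs => ?_) ha
  rw [LinearMap.mem_eqLocus, LinearMap.comp_apply, LinearMap.mulRight_apply,
    LinearMap.mulRight_apply]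
  induction x using homogeneous_induction (𝒜 := 𝒜) with
  | zero => simp
  | add x y hx hy => rw [mul_add, map_add, map_add, mul_add, hx, hy]
  | tmul m r' hr' s' =>
    rw [Algebra.TensorProduct.tmul_mul_tmul,
      diagonalProjection_tmul (SetLike.mul_mem_graded hr hr'), diagonalProjection_tmul hr',
      Algebra.TensorProduct.tmul_mul_tmul, DirectSum.coe_decompose_mul_add_of_left_mem ℬ hs]

variable (𝒜 ℬ) in
/-- The Segre product is a direct summand of `R ⊗ S` as a module over itself. -/
noncomputable def segreRetraction : R ⊗[k] S →ₗ[segreProduct 𝒜 ℬ] segreProduct 𝒜 ℬ where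
  toFun x := ⟨diagonalProjection 𝒜 ℬ x, diagonalProjection_mem x⟩
  map_add' x y := Subtype.ext (map_add _ x y)
  map_smul' a x := Subtype.ext (diagonalProjection_mul a.2 x)

theorem segreRetraction_coe (a : segreProduct 𝒜 ℬ) : segreRetraction 𝒜 ℬ (a : R ⊗[k] S) = a :=
  Subtype.ext (diagonalProjection_of_mem a.2)

/-- A direct summand of a Noetherian ring is Noetherian. -/
theorem isNoetherianRing_of_retraction {B : Type u} {C : Type v} [CommRing B] [CommRing C]
    [Algebra B C] [IsNoetherianRing C] (π : C →ₗ[B] B) (hπ : ∀ b, π (algebraMap B C b) = b) :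
    IsNoetherianRing B := by
  have hcomap (𝔟 : Ideal B) : (𝔟.map (algebraMap B C)).comap (algebraMap B C) = 𝔟 := by
    refine le_antisymm (fun b hb => ?_) Ideal.le_comap_map
    have key (c : C) (hc : c ∈ 𝔟.map (algebraMap B C)) (c' : C) : π (c' * c) ∈ 𝔟 := by
      induction hc using Submodule.span_induction generalizing c' with
      | mem c hc =>
        obtain ⟨b, hb, rfl⟩ := hc
        rw [mul_comm, ← Algebra.smul_def, map_smul]
        exact 𝔟.mul_mem_right _ hb
      | zero => rw [mul_zero, map_zero]; exact 𝔟.zero_mem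
      | add c d _ _ hc hd => rw [mul_add, map_add]; exact 𝔟.add_mem (hc c') (hd c')
      | smul c d _ hd => rw [smul_eq_mul, ← mul_assoc]; exact hd _
    have := key _ hb 1
    rwa [one_mul, hπ] at this
  have hmono : StrictMono fun 𝔟 : Ideal B => 𝔟.map (algebraMap B C) :=
    Monotone.strictMono_of_injective (fun _ _ h => Ideal.map_mono h)
      (Function.LeftInverse.injective hcomap)
  have : WellFoundedGT (Ideal C) := inferInstance
  exact isNoetherian_iff'.2 hmono.wellFoundedGT

variable (k) in
/-- A `k`-algebra, regarded first as a module over itself and then as a vector space, is the vector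
space that it was. -/
def Restricted.toAlgebra (R : Type u) [CommRing R] [Algebra k R] :
    Restricted k (R := R) R →ₗ[k] R where
  toFun r := r
  map_add' _ _ := rfl
  map_smul' c r := (@Algebra.smul_def k R _ _ _ c r).symm

variable (k R S) in
/-- The additive map underlying `OuterTensor.toTensor`. -/
noncomputable def OuterTensor.toTensorAddHom : OuterTensor k R S R S →+ R ⊗[k] S :=
  (TensorProduct.map (Restricted.toAlgebra k R) (Restricted.toAlgebra k S)).toAddMonoidHom

theorem OuterTensor.toTensorAddHom_tmul (r : R) (s : S) :
    toTensorAddHom k R S (tmul k R S r s) = r ⊗ₜ s := rfl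

variable (k R S) in
/-- The identity of `R ⊗ S`, from the tensor product of the modules `R` and `S` to the ring. -/
noncomputable def OuterTensor.toTensor : OuterTensor k R S R S →ₗ[R ⊗[k] S] R ⊗[k] S where
  __ := toTensorAddHom k R S
  map_smul' := by
    intro t x
    change toTensorAddHom k R S (t • x) = t * toTensorAddHom k R S x
    induction t using TensorProduct.induction_on with
    | zero => rw [zero_smul, map_zero, zero_mul]
    | add t t' h h' => rw [add_smul, map_add, h, h', ← add_mul]
    | tmul r s =>
      induction x using OuterTensor.induction with
      | zero => rw [smul_zero, map_zero, mul_zero]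
      | add x y h h' => rw [smul_add, map_add, h, h', map_add, mul_add]
      | tmul m n =>
        rw [smul_tmul, toTensorAddHom_tmul, toTensorAddHom_tmul,
          Algebra.TensorProduct.tmul_mul_tmul]
        rfl

variable (𝒜 ℬ)

/-- The inclusion of the Segre product in `R ⊗ S`. -/
noncomputable abbrev segreInclusion : segreProduct 𝒜 ℬ →+* R ⊗[k] S :=
  (segreProduct 𝒜 ℬ).val.toRingHom

variable {𝒜 ℬ}

/-- The vanishing passes from `R ⊗ S` to its direct summand `R # S`. -/
theorem vanishes_segreProduct_of_restrict {𝔞 : Ideal (segreProduct 𝒜 ℬ)} {i : ℕ}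
    (h : Vanishes 𝔞 i (OuterTensor.restrict (segreInclusion 𝒜 ℬ) R S)) :
    Vanishes 𝔞 i (segreProduct 𝒜 ℬ) := by
  let f : segreProduct 𝒜 ℬ →ₗ[segreProduct 𝒜 ℬ] OuterTensor.restrict (segreInclusion 𝒜 ℬ) R S :=
    LinearMap.toSpanSingleton _ (OuterTensor.restrict (segreInclusion 𝒜 ℬ) R S)
      (OuterTensor.tmul k R S (1 : R) (1 : S))
  let g : OuterTensor.restrict (segreInclusion 𝒜 ℬ) R S →ₗ[segreProduct 𝒜 ℬ] R ⊗[k] S :=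
    { toFun := OuterTensor.toTensor k R S
      map_add' := (OuterTensor.toTensor k R S).map_add
      map_smul' := fun a x => (OuterTensor.toTensor k R S).map_smul (a : R ⊗[k] S) x }
  refine h.of_retract f (segreRetraction 𝒜 ℬ ∘ₗ g) fun a => ?_
  have h1 : g (f a) = a • g (OuterTensor.tmul k R S (1 : R) (1 : S)) := g.map_smul a _
  have h2 : g (OuterTensor.tmul k R S (1 : R) (1 : S)) = 1 := rfl
  have h3 : g (f a) = (a : R ⊗[k] S) := by
    rw [h1, h2, Algebra.smul_def, mul_one]
    rfl
  rw [LinearMap.comp_apply, h3, segreRetraction_coe]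

theorem map_segreIdeal_le_left (I : Ideal R) (J : Ideal S) :
    (segreIdeal 𝒜 ℬ I J).map (segreInclusion 𝒜 ℬ) ≤
      I.map (Algebra.TensorProduct.includeLeft : R →ₐ[k] R ⊗[k] S) := by
  refine Ideal.map_le_iff_le_comap.2 fun x hx => ?_
  refine segreSubmodule_le (P := (I.map (Algebra.TensorProduct.includeLeft :
    R →ₐ[k] R ⊗[k] S)).restrictScalars k) (fun n r hr s _ => ?_) hx
  have := Ideal.mul_mem_right ((1 : R) ⊗ₜ[k] s) _ (Ideal.mem_map_of_mem
    (Algebra.TensorProduct.includeLeft : R →ₐ[k] R ⊗[k] S) (hr.2 : r ∈ I))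
  simpa using! this

theorem map_segreIdeal_le_right (I : Ideal R) (J : Ideal S) :
    (segreIdeal 𝒜 ℬ I J).map (segreInclusion 𝒜 ℬ) ≤
      J.map (Algebra.TensorProduct.includeRight : S →ₐ[k] R ⊗[k] S) := by
  refine Ideal.map_le_iff_le_comap.2 fun x hx => ?_
  refine segreSubmodule_le (P := (J.map (Algebra.TensorProduct.includeRight :
    S →ₐ[k] R ⊗[k] S)).restrictScalars k) (fun n r _ s hs => ?_) hx
  have := Ideal.mul_mem_left _ (r ⊗ₜ[k] (1 : S)) (Ideal.mem_map_of_mem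
    (Algebra.TensorProduct.includeRight : S →ₐ[k] R ⊗[k] S) (hs.2 : s ∈ J))
  simpa using! this

theorem isNoetherianRing_segreProduct (hR : IsStandardGraded 𝒜) (hS : IsStandardGraded ℬ) :
    IsNoetherianRing (segreProduct 𝒜 ℬ) := by
  have := finiteType_of_isStandardGraded hR
  have := finiteType_of_isStandardGraded hS
  have : Algebra.FiniteType k (R ⊗[k] S) := Algebra.FiniteType.trans (S := R) ‹_› inferInstance
  have : IsNoetherianRing (R ⊗[k] S) := Algebra.FiniteType.isNoetherianRing k _
  exact isNoetherianRing_of_retraction (segreRetraction 𝒜 ℬ) segreRetraction_coe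

/-- The Künneth-type bound for the Segre product: bounds `c + 1` and `d + 1` for `I` and `J` give
the bound `c + d + 1` for `I # J`. The generators of `I` and `J` up to radical are taken in one common
degree, so that their products `f ⊗ f'` lie in `I # J`. -/
theorem vanishes_segreIdeal (hR : IsStandardGraded 𝒜) (hS : IsStandardGraded ℬ)
    {I : Ideal R} {J : Ideal S} (hI : I.IsHomogeneous 𝒜) (hJ : J.IsHomogeneous ℬ)
    (hI' : I ≠ ⊤) (hJ' : J ≠ ⊤) {c d : ℕ} (hc : ∀ i, c + 1 < i → Vanishes I i R)
    (hd : ∀ i, d + 1 < i → Vanishes J i S) (i : ℕ) (hi : c + d + 1 < i) :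
    Vanishes (segreIdeal 𝒜 ℬ I J) i (segreProduct 𝒜 ℬ) := by
  have := isNoetherianRing_of_isStandardGraded hR
  have := isNoetherianRing_of_isStandardGraded hS
  have := isNoetherianRing_segreProduct hR hS
  obtain ⟨D, hD, hDF⟩ := exists_finset_subset_degree hR hI hI'
  obtain ⟨E, hE, hEF⟩ := exists_finset_subset_degree hS hJ hJ'
  obtain ⟨F, hFI, hFD, hF⟩ := hDF (D * E) (by positivity) (dvd_mul_right _ _)
  obtain ⟨F', hFJ, hFE, hF'⟩ := hEF (D * E) (by positivity) (dvd_mul_left _ _)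
  refine vanishes_segreProduct_of_restrict (OuterTensor.vanishes_of_lt hFI hF hFJ hF' ?_
    (map_segreIdeal_le_left I J) (map_segreIdeal_le_right I J) hc hd i hi)
  exact fun f hf f' hf' => ⟨⟨f ⊗ₜ f', tmul_mem_segreSubmodule (hFD f hf) (hFE f' hf')⟩,
    tmul_mem_segreSubmodule (M := fun n => 𝒜 n ⊓ I.restrictScalars k)
      (N := fun n => ℬ n ⊓ J.restrictScalars k) ⟨hFD f hf, hFI hf⟩ ⟨hFE f' hf', hFJ hf'⟩, rfl⟩

/-- If `I` or `J` is nil, so is `I # J`, and its higher local cohomology vanishes. -/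
theorem cohomologicalDimension_segreIdeal_le_zero (hR : IsStandardGraded 𝒜)
    (hS : IsStandardGraded ℬ) {I : Ideal R} {J : Ideal S}
    (h : (∀ a ∈ I, ∃ n : ℕ, a ^ n = 0) ∨ (∀ b ∈ J, ∃ n : ℕ, b ^ n = 0)) :
    cohomologicalDimension (segreIdeal 𝒜 ℬ I J) ≤ 0 := by
  have := isNoetherianRing_segreProduct hR hS
  have hnil : (segreIdeal 𝒜 ℬ I J).map (segreInclusion 𝒜 ℬ) ≤ Ideal.radical ⊥ := by
    rcases h with h | h
    · refine (map_segreIdeal_le_left I J).trans (Ideal.map_le_iff_le_comap.2 fun a ha => ?_)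
      obtain ⟨n, hn⟩ := h a ha
      exact ⟨n, by rw [← map_pow, hn, map_zero]; exact Ideal.zero_mem _⟩
    · refine (map_segreIdeal_le_right I J).trans (Ideal.map_le_iff_le_comap.2 fun b hb => ?_)
      obtain ⟨n, hn⟩ := h b hb
      exact ⟨n, by rw [← map_pow, hn, map_zero]; exact Ideal.zero_mem _⟩
  have htors : IsTorsion (segreIdeal 𝒜 ℬ I J) (segreProduct 𝒜 ℬ) := by
    intro m a ha
    obtain ⟨n, hn⟩ := hnil (Ideal.mem_map_of_mem _ ha)
    refine ⟨n, ?_⟩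
    have : a ^ n = 0 := Subtype.ext hn
    rw [this, zero_smul]
  refine cohomologicalDimension_le (n := 0) fun i hi => ?_
  obtain ⟨i, rfl⟩ : ∃ j, i = j + 1 := ⟨i - 1, by lia⟩
  exact htors.vanishes_succ i

theorem top_add_of_one_le {x : WithBot ℕ∞} (h : 1 ≤ x) : ⊤ + x = ⊤ := by
  induction x with
  | bot => simp at h
  | coe x => exact congrArg WithBot.some (top_add x)

theorem exists_eq_coe_succ {x : WithBot ℕ∞} (h1 : 1 ≤ x) (hx : x ≠ ⊤) :
    ∃ c : ℕ, x = (((c + 1 : ℕ) : ℕ∞) : WithBot ℕ∞) := by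
  induction x with
  | bot => simp at h1
  | coe x =>
    induction x with
    | top => exact absurd rfl hx
    | coe x =>
      have : 1 ≤ x := by exact_mod_cast h1
      exact ⟨x - 1, by rw [Nat.sub_add_cancel this]⟩

end Retraction

end SegreCohomology

theorem mainTheorem5 {k : Type w} {R : Type u} {S : Type v} [Field k] [CommRing R] [CommRing S]
    [Algebra k R] [Algebra k S] (𝒜 : ℕ → Submodule k R) (ℬ : ℕ → Submodule k S)
    [GradedAlgebra 𝒜] [GradedAlgebra ℬ]
    (hR : IsStandardGraded 𝒜) (hS : IsStandardGraded ℬ)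
    (I : Ideal R) (J : Ideal S) (hI : I.IsHomogeneous 𝒜) (hJ : J.IsHomogeneous ℬ)
    (hI' : I ≠ ⊤) (hJ' : J ≠ ⊤) :
    (cohomologicalDimension I * cohomologicalDimension J = 0 →
      cohomologicalDimension (segreIdeal 𝒜 ℬ I J) ≤
        cohomologicalDimension I + cohomologicalDimension J) ∧
    (1 ≤ cohomologicalDimension I → 1 ≤ cohomologicalDimension J →
      cohomologicalDimension (segreIdeal 𝒜 ℬ I J) + 1 ≤
        cohomologicalDimension I + cohomologicalDimension J) := by
  have := SegreCohomology.isNoetherianRing_of_isStandardGraded hR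
  have := SegreCohomology.isNoetherianRing_of_isStandardGraded hS
  have hI0 := SegreCohomology.zero_le_cohomologicalDimension hI'
  have hJ0 := SegreCohomology.zero_le_cohomologicalDimension hJ'
  constructor
  · intro h
    refine le_trans (SegreCohomology.cohomologicalDimension_segreIdeal_le_zero hR hS ?_)
      (add_nonneg hI0 hJ0)
    rcases mul_eq_zero.1 h with h | h
    · exact Or.inl fun a ha =>
        SegreCohomology.exists_pow_eq_zero_of_cohomologicalDimension_eq_zero hR hI hI' h ha
    · exact Or.inr fun b hb =>
        SegreCohomology.exists_pow_eq_zero_of_cohomologicalDimension_eq_zero hS hJ hJ' h hb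
  · intro hI1 hJ1
    -- an infinite summand makes the bound void
    by_cases hIt : cohomologicalDimension I = ⊤
    · rw [hIt, SegreCohomology.top_add_of_one_le hJ1]
      exact le_top
    by_cases hJt : cohomologicalDimension J = ⊤
    · rw [hJt, add_comm (cohomologicalDimension I), SegreCohomology.top_add_of_one_le hI1]
      exact le_top
    obtain ⟨c, hc⟩ := SegreCohomology.exists_eq_coe_succ hI1 hIt
    obtain ⟨d, hd⟩ := SegreCohomology.exists_eq_coe_succ hJ1 hJt
    have hle := SegreCohomology.cohomologicalDimension_le
      (SegreCohomology.vanishes_segreIdeal hR hS hI hJ hI' hJ'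
        (fun i => SegreCohomology.vanishes_of_cohomologicalDimension_le hc.le)
        (fun i => SegreCohomology.vanishes_of_cohomologicalDimension_le hd.le))
    rw [hc, hd]
    refine (add_le_add_left hle 1).trans (le_of_eq ?_)
    exact_mod_cast congrArg (fun n : ℕ => ((n : ℕ∞) : WithBot ℕ∞))
      (by lia : c + d + 1 + 1 = (c + 1) + (d + 1))
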